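/- Let $p, Q, r, s:\mathbb{R}\to\mathbb{R}$ be measurable functions such that \[ \frac{1}{\sqrt{|p|}},\ \frac{Q}{\sqrt{|p|}},\ \frac{r}{\sqrt{|p|}}\in L^2_{loc}(\mathbb{R}),\qquad s\in L^1_{loc}(\mathbb{R}),\qquad \frac1p\neq 0\ \text{ a.e.} \] Put $q=Q'+s$ (derivative in the sense of distributions) and interpret the formal differential expression $l[u]=-(pu')'+qu+i\bigl((ru)'+ru'\bigr)$ as the quasi-differential expression $l[u]:=-u^{[2]}$, where \[ u^{[1]}:=pu'-(Q+ir)u,\qquad u^{[2]}:=\bigl(u^{[1]}\bigr)'+\frac{Q-ir}{p}\,u^{[1]}+\Bigl(\frac{Q^2+r^2}{p}-s\Bigr)u . \] In the complex Hilbert space $L^2(\mathbb{R})$ let $\mathrm{L}u:=l[u]$ with domain \[ \mathrm{Dom}(\mathrm{L}):=\{u\in L^2(\mathbb{R}) : u,\,u^{[1]}\in AC_{loc}(\mathbb{R}),\ l[u]\in L^2(\mathbb{R})\}, \] and let $\mathrm{L}_{00}$ be the restriction of $\mathrm{L}$ to those $u\in\mathrm{Dom}(\mathrm{L})$ that have compact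 support. Suppose that $\mathrm{L}_{00}$ is bounded from below, i.e. there is $c\in\mathbb{R}$ with $(\mathrm{L}_{00}u,u)\ge c\,(u,u)$ for all $u\in\mathrm{Dom}(\mathrm{L}_{00})$. Suppose further that there are intervals $\Delta_n=[a_n,b_n]$, $n\in\mathbb{Z}$, with $-\infty<a_n<b_n<\infty$, $b_n\to-\infty$ as $n\to-\infty$ and $a_n\to\infty$ as $n\to\infty$, such that (i) for every $n\in\mathbb{Z}$, $p|_{\Delta_n}\in W^1_2(\Delta_n)$ and $p>0$ almost everywhere on $\Delta_n$; (ii) there is $C>0$ such that for every $n\in\mathbb{Z}$, $p(x)\le C\,|\Delta_n|^2$ for almost every $x\in\Delta_n$, where $|\Delta_n|=b_n-a_n$. (No further condition is imposed on $p$ outside the intervals $\Delta_n$; there it may vanish at some points or be discontinuous.) Then $\mathrm{L}_{00}$ is densely defined and closable, its closure is self-adjoint (that is, $\mathrm{L}_{00}$ is essentially self-adjoint), and $\mathrm{L}_{00}^*=\mathrm{L}=\mathrm{L}^*$. -/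

import Mathlib

open MeasureTheory Filter Topology
open scoped ContDiff InnerProductSpace LinearPMap

noncomputable section

namespace SturmLiouville

/-- The complex Hilbert space `L²(ℝ)`. -/
abbrev L2 : Type := Lp ℂ 2 (volume : Measure ℝ)

/-- `f ∈ L²_loc(ℝ)`: square integrable on every compact set. -/
def MemL2Loc (f : ℝ → ℝ) : Prop :=
  ∀ K : Set ℝ, IsCompact K → MemLp f 2 (volume.restrict K)

/-- `u ∈ AC_loc(ℝ)`: absolutely continuous on every compact interval. -/
def ACLoc (u : ℝ → ℂ) : Prop :=
  ∀ a b : ℝ, AbsolutelyContinuousOnInterval u a b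

/-- `f|_[a,b] ∈ W¹₂([a,b])`: `f` is in `L²(a,b)` and has a weak derivative `g` in `L²(a,b)`. -/
def MemW12 (f : ℝ → ℝ) (a b : ℝ) : Prop :=
  MemLp f 2 (volume.restrict (Set.Icc a b)) ∧
  ∃ g : ℝ → ℝ, MemLp g 2 (volume.restrict (Set.Icc a b)) ∧
    ∀ φ : ℝ → ℝ, ContDiff ℝ ∞ φ → HasCompactSupport φ → tsupport φ ⊆ Set.Ioo a b →
      ∫ x in Set.Icc a b, f x * deriv φ x = - ∫ x in Set.Icc a b, g x * φ x

/-- The standing assumptions on the real coefficients `p`, `Q`, `r`, `s` of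
`l[u] = -(p u')' + q u + i ((r u)' + r u')`, `q = Q' + s`. A real function `p` satisfies
`1 / p ≠ 0` in Lean exactly where `p ≠ 0`; in the extended sense, `p ≠ 0` almost everywhere is
forced by the local integrability of `1 / |p|`. -/
structure Admissible (p Q r s : ℝ → ℝ) : Prop where
  aemeasurable_p : AEMeasurable p volume
  ne_zero : ∀ᵐ x : ℝ, 1 / p x ≠ 0
  inv_sqrt : MemL2Loc fun x => 1 / √|p x|
  Q_div_sqrt : MemL2Loc fun x => Q x / √|p x|
  r_div_sqrt : MemL2Loc fun x => r x / √|p x|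
  s_loc : LocallyIntegrable s volume

/-- The first quasi-derivative `u^[1] = p u' - (Q + i r) u` (as an a.e. defined function). -/
def quasiDeriv₁ (p Q r : ℝ → ℝ) (u : ℝ → ℂ) (x : ℝ) : ℂ :=
  p x * deriv u x - (Q x + Complex.I * r x) * u x

/-- The second quasi-derivative
`u^[2] = (u^[1])' + (Q - i r) / p * u^[1] + ((Q² + r²) / p - s) u`,
where `v` is the absolutely continuous version of `u^[1]`. -/
def quasiDeriv₂ (p Q r s : ℝ → ℝ) (u v : ℝ → ℂ) (x : ℝ) : ℂ :=
  deriv v x + (Q x - Complex.I * r x) / p x * v x +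
    (((Q x : ℂ) ^ 2 + (r x : ℂ) ^ 2) / p x - s x) * u x

theorem ACLoc.continuous {u : ℝ → ℂ} (hu : ACLoc u) : Continuous u := by
  rw [continuous_iff_continuousAt]
  intro x
  have h := (hu (x - 1) (x + 1)).continuousOn
  rw [Set.uIcc_of_le (by linarith)] at h
  exact h.continuousAt (Icc_mem_nhds (by linarith) (by linarith))

theorem ACLoc.ae_differentiableAt {u : ℝ → ℂ} (hu : ACLoc u) :
    ∀ᵐ x : ℝ, DifferentiableAt ℝ u x := by
  have h : LocallyBoundedVariationOn u Set.univ := by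
    intro a b _ _
    rw [Set.univ_inter]
    exact (hu a b).boundedVariationOn.mono Set.Icc_subset_uIcc
  exact h.ae_differentiableAt

theorem ACLoc.add {u v : ℝ → ℂ} (hu : ACLoc u) (hv : ACLoc v) : ACLoc (u + v) :=
  fun a b => (hu a b).add (hv a b)

theorem ACLoc.smul {u : ℝ → ℂ} (c : ℂ) (hu : ACLoc u) : ACLoc (c • u) :=
  fun a b => (hu a b).const_smul c

theorem ACLoc.zero : ACLoc 0 := fun a b => by
  simpa [AbsolutelyContinuousOnInterval] using tendsto_const_nhds

/-- The graph of the maximal operator: the pairs `(f, g)` in `L²(ℝ) × L²(ℝ)` such that `f` has a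
version `u ∈ AC_loc`, `u^[1]` has a version `v ∈ AC_loc`, and `g = l[u] = -u^[2]`. -/
def maxGraph (p Q r s : ℝ → ℝ) : Submodule ℂ (L2 × L2) where
  carrier := {w | ∃ u v : ℝ → ℂ, ACLoc u ∧ ACLoc v ∧ w.1 =ᵐ[volume] u ∧
    v =ᵐ[volume] quasiDeriv₁ p Q r u ∧
    w.2 =ᵐ[volume] fun x => -quasiDeriv₂ p Q r s u v x}
  zero_mem' := by
    refine ⟨0, 0, ACLoc.zero, ACLoc.zero, Lp.coeFn_zero _ _ _, ?_, ?_⟩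
    · refine Eventually.of_forall fun x => ?_
      simp [quasiDeriv₁]
    · refine (Lp.coeFn_zero ℂ 2 volume).trans (Eventually.of_forall fun x => ?_)
      simp [quasiDeriv₂]
  add_mem' := by
    rintro ⟨f, g⟩ ⟨f', g'⟩ ⟨u, v, hu, hv, h1, h2, h3⟩ ⟨u', v', hu', hv', h1', h2', h3'⟩
    refine ⟨u + u', v + v', hu.add hu', hv.add hv', (Lp.coeFn_add f f').trans (h1.add h1'), ?_, ?_⟩
    · filter_upwards [h2, h2', hu.ae_differentiableAt, hu'.ae_differentiableAt]
        with x e e' d d'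
      simp only [Pi.add_apply, e, e', quasiDeriv₁, deriv_add d d']
      ring
    · filter_upwards [Lp.coeFn_add g g', h3, h3', hv.ae_differentiableAt, hv'.ae_differentiableAt]
        with x e0 e e' d d'
      simp only [Prod.mk_add_mk, e0, Pi.add_apply, e, e', quasiDeriv₂, deriv_add d d']
      ring
  smul_mem' := by
    rintro c ⟨f, g⟩ ⟨u, v, hu, hv, h1, h2, h3⟩
    refine ⟨c • u, c • v, hu.smul c, hv.smul c, (Lp.coeFn_smul c f).trans (h1.const_smul c), ?_, ?_⟩
    · filter_upwards [h2, hu.ae_differentiableAt] with x e d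
      simp only [Pi.smul_apply, e, quasiDeriv₁, deriv_const_smul c d, smul_eq_mul]
      ring
    · filter_upwards [Lp.coeFn_smul c g, h3, hv.ae_differentiableAt] with x e0 e d
      simp only [Prod.smul_mk, e0, Pi.smul_apply, e, quasiDeriv₂, deriv_const_smul c d,
        smul_eq_mul]
      ring

theorem maxGraph_functional (p Q r s : ℝ → ℝ) (w : L2 × L2) (hw : w ∈ maxGraph p Q r s)
    (h0 : w.1 = 0) : w.2 = 0 := by
  obtain ⟨u, v, hu, hv, h1, h2, h3⟩ := hw
  have hu0 : u = 0 := by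
    refine (hu.continuous.ae_eq_iff_eq volume continuous_zero).1 ?_
    rw [h0] at h1
    exact h1.symm.trans (Lp.coeFn_zero _ _ _)
  have hv0 : v = 0 := by
    refine (hv.continuous.ae_eq_iff_eq volume continuous_zero).1 ?_
    refine h2.trans (Eventually.of_forall fun x => ?_)
    simp [quasiDeriv₁, hu0]
  refine Lp.ext (h3.trans (EventuallyEq.trans ?_ (Lp.coeFn_zero _ _ _).symm))
  refine Eventually.of_forall fun x => ?_
  simp [quasiDeriv₂, hu0, hv0]

/-- The maximal operator `L`. -/
def maxOp (p Q r s : ℝ → ℝ) : L2 →ₗ.[ℂ] L2 := (maxGraph p Q r s).toLinearPMap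

/-- `maxGraph` is a functional graph, so it is the graph of `L`. -/
theorem graph_maxOp (p Q r s : ℝ → ℝ) : (maxOp p Q r s).graph = maxGraph p Q r s :=
  Submodule.toLinearPMap_graph_eq _ (maxGraph_functional p Q r s)

/-- The elements of `L²(ℝ)` that have a compactly supported version. -/
def compactlySupported : Submodule ℂ L2 where
  carrier := {f | ∃ u : ℝ → ℂ, HasCompactSupport u ∧ f =ᵐ[volume] u}
  zero_mem' := ⟨0, HasCompactSupport.zero, Lp.coeFn_zero _ _ _⟩
  add_mem' := by
    rintro f g ⟨u, hu, hf⟩ ⟨v, hv, hg⟩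
    exact ⟨u + v, hu.add hv, (Lp.coeFn_add f g).trans (hf.add hg)⟩
  smul_mem' := by
    rintro c f ⟨u, hu, hf⟩
    exact ⟨c • u, hu.smul_left (f := fun _ => c), (Lp.coeFn_smul c f).trans (hf.const_smul c)⟩

/-- The preminimal operator `L₀₀`: the restriction of `L` to the elements of its domain with
compact support. -/
def preminOp (p Q r s : ℝ → ℝ) : L2 →ₗ.[ℂ] L2 :=
  (maxOp p Q r s).domRestrict compactlySupported

/-- `(T u, u) ≥ c (u, u)` on the domain of `T`, for some real `c`. -/
def BoundedBelow (T : L2 →ₗ.[ℂ] L2) : Prop :=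
  ∃ c : ℝ, ∀ u : T.domain, c * ‖(u : L2)‖ ^ 2 ≤ (⟪(u : L2), T u⟫_ℂ).re

/-- `T` is densely defined and closable, and its closure is self-adjoint. -/
def EssentiallySelfAdjoint (T : L2 →ₗ.[ℂ] L2) : Prop :=
  Dense (T.domain : Set L2) ∧ T.IsClosable ∧ IsSelfAdjoint T.closure

end SturmLiouville

end

noncomputable section

namespace SturmLiouville

open scoped ComplexConjugate

/-! ### Absolutely continuous functions -/

/-- Composing an absolutely continuous function with a Lipschitz function. -/
theorem absolutelyContinuousOnInterval_lipschitz_comp {X Y : Type*} [PseudoMetricSpace X]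
    [PseudoMetricSpace Y] {f : ℝ → X} {φ : X → Y} {K : NNReal} {a b : ℝ}
    (hf : AbsolutelyContinuousOnInterval f a b)
    (hφ : LipschitzOnWith K φ (f '' Set.uIcc a b)) :
    AbsolutelyContinuousOnInterval (fun x => φ (f x)) a b := by
  unfold AbsolutelyContinuousOnInterval at hf ⊢
  apply squeeze_zero' ?_ ?_ (by simpa using hf.const_mul (K : ℝ))
  · exact Eventually.of_forall fun _ => Finset.sum_nonneg fun i _ => dist_nonneg
  rw [eventually_inf_principal]
  filter_upwards with E hE
  rw [Finset.mul_sum]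
  refine Finset.sum_le_sum fun i hi => ?_
  exact hφ.dist_le_mul _ ⟨_, (hE.1 i hi).1, rfl⟩ _ ⟨_, (hE.1 i hi).2, rfl⟩

theorem ACLoc.sub {u v : ℝ → ℂ} (hu : ACLoc u) (hv : ACLoc v) : ACLoc (fun x => u x - v x) :=
  fun a b => (hu a b).fun_sub (hv a b)

theorem ACLoc.mul {u v : ℝ → ℂ} (hu : ACLoc u) (hv : ACLoc v) : ACLoc (fun x => u x * v x) :=
  fun a b => (hu a b).fun_smul (hv a b)

theorem ACLoc.conj {u : ℝ → ℂ} (hu : ACLoc u) : ACLoc (fun x => (starRingEnd ℂ) (u x)) :=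
  fun a b => absolutelyContinuousOnInterval_lipschitz_comp (hu a b)
    (Complex.conjLIE.lipschitz.lipschitzOnWith)

theorem ACLoc.re {u : ℝ → ℂ} (hu : ACLoc u) (a b : ℝ) :
    AbsolutelyContinuousOnInterval (fun x => (u x).re) a b :=
  absolutelyContinuousOnInterval_lipschitz_comp (hu a b)
    (Complex.reCLM.lipschitz.lipschitzOnWith)

theorem ACLoc.im {u : ℝ → ℂ} (hu : ACLoc u) (a b : ℝ) :
    AbsolutelyContinuousOnInterval (fun x => (u x).im) a b :=
  absolutelyContinuousOnInterval_lipschitz_comp (hu a b)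
    (Complex.imCLM.lipschitz.lipschitzOnWith)

theorem ACLoc.ofReal {f : ℝ → ℝ} (hf : ∀ a b, AbsolutelyContinuousOnInterval f a b) :
    ACLoc (fun x => (f x : ℂ)) :=
  fun a b => absolutelyContinuousOnInterval_lipschitz_comp (hf a b)
    (Complex.ofRealCLM.lipschitz.lipschitzOnWith)

theorem ACLoc.of_contDiff {u : ℝ → ℂ} (hu : ContDiff ℝ 1 u) : ACLoc u :=
  fun _ _ => hu.contDiffOn.absolutelyContinuousOnInterval

theorem deriv_re_ae {u : ℝ → ℂ} (hu : ACLoc u) :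
    deriv (fun x => (u x).re) =ᵐ[volume] fun x => (deriv u x).re := by
  filter_upwards [hu.ae_differentiableAt] with x hx
  exact (Complex.reCLM.hasFDerivAt.comp_hasDerivAt x hx.hasDerivAt).deriv

theorem deriv_im_ae {u : ℝ → ℂ} (hu : ACLoc u) :
    deriv (fun x => (u x).im) =ᵐ[volume] fun x => (deriv u x).im := by
  filter_upwards [hu.ae_differentiableAt] with x hx
  exact (Complex.imCLM.hasFDerivAt.comp_hasDerivAt x hx.hasDerivAt).deriv

theorem ACLoc.intervalIntegrable_deriv {u : ℝ → ℂ} (hu : ACLoc u) (a b : ℝ) :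
    IntervalIntegrable (deriv u) volume a b := by
  have h1 : IntervalIntegrable (fun x => (deriv u x).re) volume a b :=
    (hu.re a b).intervalIntegrable_deriv.congr_ae (ae_restrict_of_ae (deriv_re_ae hu))
  have h2 : IntervalIntegrable (fun x => (deriv u x).im) volume a b :=
    (hu.im a b).intervalIntegrable_deriv.congr_ae (ae_restrict_of_ae (deriv_im_ae hu))
  rw [intervalIntegrable_iff] at h1 h2 ⊢
  have h := h1.ofReal (𝕜 := ℂ) |>.add (h2.ofReal (𝕜 := ℂ) |>.mul_const Complex.I)
  refine h.congr (Eventually.of_forall fun x => ?_)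
  simp

theorem ACLoc.integral_deriv {u : ℝ → ℂ} (hu : ACLoc u) (a b : ℝ) :
    ∫ x in a..b, deriv u x = u b - u a := by
  have hi := hu.intervalIntegrable_deriv a b
  have h1 : ∫ x in a..b, (deriv u x).re = (u b).re - (u a).re := by
    rw [← (hu.re a b).integral_deriv_eq_sub]
    exact intervalIntegral.integral_congr_ae
      ((deriv_re_ae hu).mono fun x hx _ => hx.symm)
  have h2 : ∫ x in a..b, (deriv u x).im = (u b).im - (u a).im := by
    rw [← (hu.im a b).integral_deriv_eq_sub]
    exact intervalIntegral.integral_congr_ae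
      ((deriv_im_ae hu).mono fun x hx _ => hx.symm)
  apply Complex.ext
  · rw [Complex.sub_re, ← h1]
    exact (Complex.reCLM.intervalIntegral_comp_comm hi).symm
  · rw [Complex.sub_im, ← h2]
    exact (Complex.imCLM.intervalIntegral_comp_comm hi).symm

theorem intervalIntegrable_of_locallyIntegrable {E : Type*} [NormedAddCommGroup E] {f : ℝ → E}
    (hf : LocallyIntegrable f volume) (a b : ℝ) : IntervalIntegrable f volume a b :=
  (hf.integrableOn_isCompact isCompact_uIcc).intervalIntegrable

theorem absolutelyContinuousOnInterval_integral {f : ℝ → ℝ} (hf : LocallyIntegrable f volume)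
    (c a b : ℝ) : AbsolutelyContinuousOnInterval (fun x => ∫ t in c..x, f t) a b := by
  have hle : min c (min a b) ≤ max c (max a b) :=
    (min_le_left _ _).trans (le_max_left _ _)
  have hc : c ∈ Set.uIcc (min c (min a b)) (max c (max a b)) := by
    rw [Set.uIcc_of_le hle]
    exact ⟨min_le_left _ _, le_max_left _ _⟩
  refine ((intervalIntegrable_of_locallyIntegrable hf _ _
    ).absolutelyContinuousOnInterval_intervalIntegral hc).mono ?_
  rw [Set.uIcc_of_le hle]
  exact Set.Icc_subset_Icc (min_le_right _ _) (le_max_right _ _)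

theorem ACLoc.of_integral {f : ℝ → ℂ} (hf : LocallyIntegrable f volume) (c : ℝ) :
    ACLoc (fun x => ∫ t in c..x, f t) := by
  have h1 : LocallyIntegrable (fun x => (f x).re) volume := fun x => by
    obtain ⟨s, hs, h⟩ := hf x
    exact ⟨s, hs, h.re⟩
  have h2 : LocallyIntegrable (fun x => (f x).im) volume := fun x => by
    obtain ⟨s, hs, h⟩ := hf x
    exact ⟨s, hs, h.im⟩
  have h : ACLoc ((fun x => ((∫ t in c..x, (f t).re : ℝ) : ℂ)) +
      Complex.I • fun x => ((∫ t in c..x, (f t).im : ℝ) : ℂ)) :=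
    (ACLoc.ofReal (absolutelyContinuousOnInterval_integral h1 c)).add
      ((ACLoc.ofReal (absolutelyContinuousOnInterval_integral h2 c)).smul _)
  convert h using 1
  ext x
  have hi := intervalIntegrable_of_locallyIntegrable hf c x
  have e1 := Complex.reCLM.intervalIntegral_comp_comm hi
  have e2 := Complex.imCLM.intervalIntegral_comp_comm hi
  simp only [Complex.reCLM_apply, Complex.imCLM_apply] at e1 e2
  simp only [Pi.add_apply, Pi.smul_apply, e1, e2, smul_eq_mul]
  rw [mul_comm, Complex.re_add_im]

theorem deriv_integral_ae {E : Type*} [NormedAddCommGroup E] [NormedSpace ℝ E] [CompleteSpace E]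
    {f : ℝ → E} (hf : LocallyIntegrable f volume) (c : ℝ) :
    ∀ᵐ x : ℝ, HasDerivAt (fun x => ∫ t in c..x, f t) (f x) x := by
  filter_upwards [LocallyIntegrable.ae_hasDerivAt_integral hf] with x hx using hx c

/-! ### Linear systems with locally integrable coefficients -/

theorem locallyIntegrable_norm {E : Type*} [NormedAddCommGroup E] {f : ℝ → E}
    (hf : LocallyIntegrable f volume) : LocallyIntegrable (fun x => ‖f x‖) volume :=
  hf.mono hf.aestronglyMeasurable.norm (by simp)

theorem locallyIntegrable_clm_apply {E F : Type*} [NormedAddCommGroup E] [NormedSpace ℝ E]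
    [NormedAddCommGroup F] [NormedSpace ℝ F]
    {A : ℝ → E →L[ℝ] F} (hA : LocallyIntegrable A volume) {y : ℝ → E} (hy : Continuous y) :
    LocallyIntegrable (fun t => A t (y t)) volume := by
  refine (LocallyIntegrable.continuous_smul hy.norm (locallyIntegrable_norm hA)).mono
    ((ContinuousLinearMap.id ℝ (E →L[ℝ] F)).aestronglyMeasurable_comp₂ hA.aestronglyMeasurable
      hy.aestronglyMeasurable) (Eventually.of_forall fun x => ?_)
  simpa [mul_comm] using (A x).le_opNorm (y x)

/-- Grönwall-type weight estimate. -/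
theorem abs_integral_mul_exp_le {a : ℝ → ℝ} (ha : LocallyIntegrable a volume) (ha0 : ∀ t, 0 ≤ a t)
    (c x : ℝ) :
    |∫ t in c..x, a t * Real.exp (2 * |∫ τ in c..t, a τ|)| ≤
      Real.exp (2 * |∫ τ in c..x, a τ|) / 2 := by
  have key : ∀ ε : ℝ, ∫ t in c..x, 2 * ε * (a t * Real.exp (2 * (ε * ∫ τ in c..t, a τ))) =
      Real.exp (2 * (ε * ∫ τ in c..x, a τ)) - 1 := by
    intro ε
    set M : ℝ → ℝ := fun x => ∫ τ in c..x, a τ with hM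
    have hMac : AbsolutelyContinuousOnInterval M c x :=
      absolutelyContinuousOnInterval_integral ha c c x
    have hcomp : IsCompact (M '' Set.uIcc c x) := isCompact_uIcc.image_of_continuousOn
      hMac.continuousOn
    obtain ⟨R, hR⟩ := hcomp.isBounded.subset_closedBall 0
    have hsm : ContDiff ℝ 1 fun z : ℝ => Real.exp (2 * (ε * z)) := by fun_prop
    obtain ⟨K, hK⟩ := hsm.contDiffOn.exists_lipschitzOnWith (by decide)
      (convex_closedBall (0 : ℝ) R) (isCompact_closedBall 0 R)
    have hW := absolutelyContinuousOnInterval_lipschitz_comp hMac (hK.mono hR)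
    have h := hW.integral_deriv_eq_sub
    have h0 : M c = 0 := by simp [hM]
    rw [h0, mul_zero, mul_zero, Real.exp_zero] at h
    rw [← h]
    refine intervalIntegral.integral_congr_ae ?_
    filter_upwards [deriv_integral_ae ha c] with t ht _
    have := ((ht.const_mul ε).const_mul 2).exp
    rw [this.deriv]
    ring
  rcases le_total c x with h | h
  · have h1 : ∀ t, c ≤ t → |∫ τ in c..t, a τ| = 1 * ∫ τ in c..t, a τ := fun t ht => by
      rw [one_mul, abs_of_nonneg (intervalIntegral.integral_nonneg ht fun u _ => ha0 u)]
    have e := key 1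
    rw [← h1 x h] at e
    have e' : ∫ t in c..x, 2 * 1 * (a t * Real.exp (2 * (1 * ∫ τ in c..t, a τ))) =
        2 * ∫ t in c..x, a t * Real.exp (2 * |∫ τ in c..t, a τ|) := by
      rw [← intervalIntegral.integral_const_mul]
      refine intervalIntegral.integral_congr fun t ht => ?_
      rw [Set.uIcc_of_le h] at ht
      simp only [h1 t ht.1, mul_one]
    rw [e'] at e
    rw [abs_of_nonneg (intervalIntegral.integral_nonneg h fun u _ =>
      mul_nonneg (ha0 u) (Real.exp_nonneg _))]
    linarith
  · have h1 : ∀ t, t ≤ c → |∫ τ in c..t, a τ| = -1 * ∫ τ in c..t, a τ := fun t ht => by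
      rw [intervalIntegral.integral_symm, abs_neg,
        abs_of_nonneg (intervalIntegral.integral_nonneg ht fun u _ => ha0 u)]
      ring
    have e := key (-1)
    rw [← h1 x h] at e
    have e' : ∫ t in c..x, 2 * -1 * (a t * Real.exp (2 * (-1 * ∫ τ in c..t, a τ))) =
        -2 * ∫ t in c..x, a t * Real.exp (2 * |∫ τ in c..t, a τ|) := by
      rw [← intervalIntegral.integral_const_mul]
      refine intervalIntegral.integral_congr fun t ht => ?_
      rw [Set.uIcc_of_ge h] at ht
      simp only [h1 t ht.2]
      ring
    rw [e'] at e
    have h2 : ∫ t in c..x, a t * Real.exp (2 * |∫ τ in c..t, a τ|) ≤ 0 := by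
      rw [intervalIntegral.integral_symm, neg_nonpos]
      exact intervalIntegral.integral_nonneg h fun u _ => mul_nonneg (ha0 u) (Real.exp_nonneg _)
    rw [abs_of_nonpos h2]
    linarith

/-- Carathéodory existence: a linear system `y' = A y + F` with locally integrable coefficients
has a global solution with prescribed value at `c`. -/
theorem exists_integral_eq {E : Type*} [NormedAddCommGroup E] [NormedSpace ℝ E] [CompleteSpace E]
    {A : ℝ → E →L[ℝ] E} {F : ℝ → E} (hA : LocallyIntegrable A volume)
    (hF : LocallyIntegrable F volume) (c : ℝ) (y₀ : E) :
    ∃ y : ℝ → E, Continuous y ∧ ∀ x, y x = y₀ + ∫ t in c..x, (A t (y t) + F t) := by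
  set a : ℝ → ℝ := fun t => ‖A t‖ + ‖F t‖ with ha_def
  have ha : LocallyIntegrable a volume := (locallyIntegrable_norm hA).add (locallyIntegrable_norm hF)
  have ha0 : ∀ t, 0 ≤ a t := fun t => by positivity
  set m : ℝ → ℝ := fun x => |∫ t in c..x, a t| with hm_def
  have hm0 : ∀ x, 0 ≤ m x := fun x => abs_nonneg _
  have hmc : Continuous m := (intervalIntegral.continuous_primitive
    (intervalIntegrable_of_locallyIntegrable ha) c).abs
  set w : ℝ → ℝ := fun x => Real.exp (2 * m x) with hw_def
  have hwc : Continuous w := by fun_prop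
  have hw0 : ∀ x, 0 < w x := fun x => Real.exp_pos _
  have hw1 : ∀ x, 1 ≤ w x := fun x => Real.one_le_exp (by linarith [hm0 x])
  have hmw : ∀ x, m x ≤ w x := fun x => by
    have := Real.add_one_le_exp (2 * m x)
    linarith [hm0 x]
  have haw : LocallyIntegrable (fun t => a t * w t) volume := by
    simpa only [smul_eq_mul] using LocallyIntegrable.smul_continuous hwc ha
  have hInt : ∀ {y : ℝ → E}, Continuous y → LocallyIntegrable (fun t => A t (y t) + F t) volume :=
    fun hy => (locallyIntegrable_clm_apply hA hy).add hF
  have hlin : ∀ (y : ℝ → E) (C : ℝ), (∀ t, ‖y t‖ ≤ C * w t) → ∀ x,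
      ‖∫ t in c..x, A t (y t)‖ ≤ C * (w x / 2) := by
    intro y C hy x
    have hC : 0 ≤ C := by
      have := (norm_nonneg _).trans (hy 0)
      exact nonneg_of_mul_nonneg_left this (hw0 0)
    have h1 : ‖∫ t in c..x, A t (y t)‖ ≤ |∫ t in c..x, C * (a t * w t)| := by
      refine intervalIntegral.norm_integral_le_abs_of_norm_le (Eventually.of_forall fun t => ?_)
        ((intervalIntegrable_of_locallyIntegrable haw _ _).const_mul C)
      calc ‖A t (y t)‖ ≤ ‖A t‖ * ‖y t‖ := (A t).le_opNorm _
        _ ≤ a t * (C * w t) := by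
          refine mul_le_mul ?_ (hy t) (norm_nonneg _) (ha0 t)
          simp [ha_def]
        _ = C * (a t * w t) := by ring
    rw [intervalIntegral.integral_const_mul, abs_mul, abs_of_nonneg hC] at h1
    exact h1.trans (mul_le_mul_of_nonneg_left (abs_integral_mul_exp_le ha ha0 c x) hC)
  have hFb : ∀ x, ‖∫ t in c..x, F t‖ ≤ w x := fun x => by
    refine le_trans ?_ (hmw x)
    refine intervalIntegral.norm_integral_le_abs_of_norm_le (Eventually.of_forall fun t => ?_)
      (intervalIntegrable_of_locallyIntegrable ha _ _)
    simp [ha_def]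
  have hwz : ∀ z : BoundedContinuousFunction ℝ E, Continuous fun t => w t • z t :=
    fun z => hwc.smul z.continuous
  have hwzb : ∀ z : BoundedContinuousFunction ℝ E, ∀ t, ‖w t • z t‖ ≤ ‖z‖ * w t := fun z t => by
    rw [norm_smul, Real.norm_of_nonneg (hw0 t).le, mul_comm]
    exact mul_le_mul_of_nonneg_right (z.norm_coe_le_norm t) (hw0 t).le
  let Φ : BoundedContinuousFunction ℝ E → BoundedContinuousFunction ℝ E := fun z =>
    BoundedContinuousFunction.ofNormedAddCommGroup
      (fun x => (w x)⁻¹ • (y₀ + ∫ t in c..x, (A t (w t • z t) + F t)))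
      ((hwc.inv₀ fun x => (hw0 x).ne').smul (continuous_const.add
        (intervalIntegral.continuous_primitive
          (intervalIntegrable_of_locallyIntegrable (hInt (hwz z))) c)))
      (‖y₀‖ + ‖z‖ + 1) (by
        intro x
        rw [norm_smul, norm_inv, Real.norm_of_nonneg (hw0 x).le, inv_mul_le_iff₀ (hw0 x),
          intervalIntegral.integral_add (intervalIntegrable_of_locallyIntegrable
            (locallyIntegrable_clm_apply hA (hwz z)) _ _)
            (intervalIntegrable_of_locallyIntegrable hF _ _)]
        have h1 := hlin _ _ (hwzb z) x
        have h2 := hFb x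
        have h3 := norm_add₃_le (a := y₀) (b := ∫ t in c..x, A t (w t • z t))
          (c := ∫ t in c..x, F t)
        rw [add_assoc] at h3
        have h4 : ‖y₀‖ ≤ w x * ‖y₀‖ := le_mul_of_one_le_left (norm_nonneg _) (hw1 x)
        have h5 : 0 ≤ ‖z‖ * w x := mul_nonneg (norm_nonneg _) (hw0 x).le
        nlinarith)
  have hΦ : ContractingWith (1 / 2) Φ := by
    refine ⟨by rw [← NNReal.coe_lt_coe]; norm_num, LipschitzWith.of_dist_le_mul fun z z' => ?_⟩
    rw [BoundedContinuousFunction.dist_le (by positivity)]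
    intro x
    have h1 : ∀ z : BoundedContinuousFunction ℝ E, IntervalIntegrable
        (fun t => A t (w t • z t) + F t) volume c x := fun z =>
      intervalIntegrable_of_locallyIntegrable (hInt (hwz z)) c x
    have h2 : Φ z x - Φ z' x = (w x)⁻¹ • ∫ t in c..x, A t (w t • (z - z') t) := by
      change (w x)⁻¹ • (y₀ + ∫ t in c..x, (A t (w t • z t) + F t)) -
        (w x)⁻¹ • (y₀ + ∫ t in c..x, (A t (w t • z' t) + F t)) = _
      rw [← smul_sub, add_sub_add_left_eq_sub, ← intervalIntegral.integral_sub (h1 z) (h1 z')]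
      congr 1
      refine intervalIntegral.integral_congr fun t _ => ?_
      simp [smul_sub]
    rw [dist_eq_norm, h2, norm_smul, norm_inv, Real.norm_of_nonneg (hw0 x).le,
      inv_mul_le_iff₀ (hw0 x), dist_eq_norm]
    refine (hlin _ _ (hwzb (z - z')) x).trans (le_of_eq ?_)
    push_cast
    ring
  set z := ContractingWith.fixedPoint Φ hΦ with hz
  refine ⟨fun t => w t • z t, hwz z, fun x => ?_⟩
  have h := congrArg (fun f : BoundedContinuousFunction ℝ E => f x) hΦ.fixedPoint_isFixedPt
  have h' : (w x)⁻¹ • (y₀ + ∫ t in c..x, (A t (w t • z t) + F t)) = z x := h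
  change w x • z x = _
  rw [← h', smul_inv_smul₀ (hw0 x).ne']

/-! ### Local integrability of the coefficients -/

theorem MemL2Loc.locallyIntegrable_mul {f g : ℝ → ℝ} (hf : MemL2Loc f) (hg : MemL2Loc g) :
    LocallyIntegrable (fun x => f x * g x) volume :=
  locallyIntegrable_iff.2 fun K hK => (hf K hK).integrable_mul (hg K hK)

theorem MemL2Loc.aestronglyMeasurable {f : ℝ → ℝ} (hf : MemL2Loc f) :
    AEStronglyMeasurable f volume := by
  refine LocallyIntegrable.aestronglyMeasurable (locallyIntegrable_iff.2 fun K hK => ?_)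
  have : IsFiniteMeasure (volume.restrict K) := ⟨by simpa using hK.measure_lt_top⟩
  exact (hf K hK).integrable (by norm_num)

theorem Admissible.p_ne_zero {p Q r s : ℝ → ℝ} (h : Admissible p Q r s) : ∀ᵐ x : ℝ, p x ≠ 0 := by
  filter_upwards [h.ne_zero] with x hx
  simpa using hx

theorem Admissible.aestronglyMeasurable_of_div {p Q r s : ℝ → ℝ} (h : Admissible p Q r s)
    {f : ℝ → ℝ} (hf : MemL2Loc fun x => f x / √|p x|) : AEStronglyMeasurable f volume := by
  have h1 : AEMeasurable (fun x => f x / √|p x| * √|p x|) volume :=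
    hf.aestronglyMeasurable.aemeasurable.mul h.aemeasurable_p.abs.sqrt
  refine (h1.congr ?_).aestronglyMeasurable
  filter_upwards [h.p_ne_zero] with x hx
  have : √|p x| ≠ 0 := (Real.sqrt_pos.2 (abs_pos.2 hx)).ne'
  field_simp

theorem Admissible.locallyIntegrable_mul_div {p Q r s : ℝ → ℝ} (h : Admissible p Q r s)
    {f g : ℝ → ℝ} (hf : MemL2Loc fun x => f x / √|p x|) (hg : MemL2Loc fun x => g x / √|p x|) :
    LocallyIntegrable (fun x => f x * g x / p x) volume := by
  refine (hf.locallyIntegrable_mul hg).mono ?_ (Eventually.of_forall fun x => le_of_eq ?_)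
  · exact (((h.aestronglyMeasurable_of_div hf).aemeasurable.mul
      (h.aestronglyMeasurable_of_div hg).aemeasurable).div h.aemeasurable_p).aestronglyMeasurable
  · rw [div_mul_div_comm, Real.mul_self_sqrt (abs_nonneg _), norm_div, norm_div,
      Real.norm_eq_abs |p x|, abs_abs, Real.norm_eq_abs (p x)]

theorem locallyIntegrable_ofReal {f : ℝ → ℝ} (hf : LocallyIntegrable f volume) :
    LocallyIntegrable (fun x => (f x : ℂ)) volume :=
  hf.mono (Complex.continuous_ofReal.comp_aestronglyMeasurable hf.aestronglyMeasurable) (by simp)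

/-! ### Solutions of the quasi-differential equation -/

/-- `u` solves `l[u] = g`, and `v` is the absolutely continuous version of `u^[1]`. -/
structure IsQuasiSolution (p Q r s : ℝ → ℝ) (u v g : ℝ → ℂ) : Prop where
  ac : ACLoc u
  ac_quasiDeriv : ACLoc v
  quasiDeriv_eq : v =ᵐ[volume] quasiDeriv₁ p Q r u
  eq : g =ᵐ[volume] fun x => -quasiDeriv₂ p Q r s u v x

theorem mem_maxGraph_iff {p Q r s : ℝ → ℝ} {w : L2 × L2} :
    w ∈ maxGraph p Q r s ↔ ∃ u v, w.1 =ᵐ[volume] u ∧ IsQuasiSolution p Q r s u v w.2 :=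
  ⟨fun ⟨u, v, hu, hv, h1, h2, h3⟩ => ⟨u, v, h1, hu, hv, h2, h3⟩,
    fun ⟨u, v, h1, hu, hv, h2, h3⟩ => ⟨u, v, hu, hv, h1, h2, h3⟩⟩

theorem IsQuasiSolution.add {p Q r s : ℝ → ℝ} {u v g u' v' g' : ℝ → ℂ}
    (h : IsQuasiSolution p Q r s u v g) (h' : IsQuasiSolution p Q r s u' v' g') :
    IsQuasiSolution p Q r s (u + u') (v + v') (g + g') := by
  refine ⟨h.ac.add h'.ac, h.ac_quasiDeriv.add h'.ac_quasiDeriv, ?_, ?_⟩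
  · filter_upwards [h.quasiDeriv_eq, h'.quasiDeriv_eq, h.ac.ae_differentiableAt,
      h'.ac.ae_differentiableAt] with x e e' d d'
    simp only [Pi.add_apply, e, e', quasiDeriv₁, deriv_add d d']
    ring
  · filter_upwards [h.eq, h'.eq, h.ac_quasiDeriv.ae_differentiableAt,
      h'.ac_quasiDeriv.ae_differentiableAt] with x e e' d d'
    simp only [Pi.add_apply, e, e', quasiDeriv₂, deriv_add d d']
    ring

theorem IsQuasiSolution.smul {p Q r s : ℝ → ℝ} {u v g : ℝ → ℂ} (c : ℂ)
    (h : IsQuasiSolution p Q r s u v g) :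
    IsQuasiSolution p Q r s (c • u) (c • v) (c • g) := by
  refine ⟨h.ac.smul c, h.ac_quasiDeriv.smul c, ?_, ?_⟩
  · filter_upwards [h.quasiDeriv_eq, h.ac.ae_differentiableAt] with x e d
    simp only [Pi.smul_apply, e, quasiDeriv₁, deriv_const_smul c d, smul_eq_mul]
    ring
  · filter_upwards [h.eq, h.ac_quasiDeriv.ae_differentiableAt] with x e d
    simp only [Pi.smul_apply, e, quasiDeriv₂, deriv_const_smul c d, smul_eq_mul]
    ring

theorem IsQuasiSolution.congr {p Q r s : ℝ → ℝ} {u v g g' : ℝ → ℂ}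
    (h : IsQuasiSolution p Q r s u v g) (hg : g' =ᵐ[volume] g) :
    IsQuasiSolution p Q r s u v g' :=
  ⟨h.ac, h.ac_quasiDeriv, h.quasiDeriv_eq, hg.trans h.eq⟩

theorem locallyIntegrable_fun_add {E : Type*} [NormedAddCommGroup E] {f g : ℝ → E}
    (hf : LocallyIntegrable f volume) (hg : LocallyIntegrable g volume) :
    LocallyIntegrable (fun x => f x + g x) volume :=
  hf.add hg

theorem Admissible.exists_isQuasiSolution {p Q r s : ℝ → ℝ} (hc : Admissible p Q r s) {g : ℝ → ℂ}
    (hg : LocallyIntegrable g volume) (c : ℝ) (α β : ℂ) :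
    ∃ u v, IsQuasiSolution p Q r s u v g ∧ u c = α ∧ v c = β := by
  have k1 : LocallyIntegrable (fun x => ((1 / p x : ℝ) : ℂ)) volume :=
    locallyIntegrable_ofReal (by simpa using hc.locallyIntegrable_mul_div hc.inv_sqrt hc.inv_sqrt)
  have kQ : LocallyIntegrable (fun x => ((Q x / p x : ℝ) : ℂ)) volume :=
    locallyIntegrable_ofReal (by
      simpa using hc.locallyIntegrable_mul_div hc.Q_div_sqrt hc.inv_sqrt)
  have kr : LocallyIntegrable (fun x => ((r x / p x : ℝ) : ℂ)) volume :=
    locallyIntegrable_ofReal (by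
      simpa using hc.locallyIntegrable_mul_div hc.r_div_sqrt hc.inv_sqrt)
  have kQQ : LocallyIntegrable (fun x => ((Q x * Q x / p x : ℝ) : ℂ)) volume :=
    locallyIntegrable_ofReal (hc.locallyIntegrable_mul_div hc.Q_div_sqrt hc.Q_div_sqrt)
  have krr : LocallyIntegrable (fun x => ((r x * r x / p x : ℝ) : ℂ)) volume :=
    locallyIntegrable_ofReal (hc.locallyIntegrable_mul_div hc.r_div_sqrt hc.r_div_sqrt)
  have ks : LocallyIntegrable (fun x => (s x : ℂ)) volume := locallyIntegrable_ofReal hc.s_loc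
  have kuu := kQ.add (kr.smul Complex.I)
  have kvv := (kr.smul Complex.I).sub kQ
  have kvu := (ks.sub kQQ).sub krr
  let fst := ContinuousLinearMap.fst ℝ ℂ ℂ
  let snd := ContinuousLinearMap.snd ℝ ℂ ℂ
  let inl := ContinuousLinearMap.inl ℝ ℂ ℂ
  let inr := ContinuousLinearMap.inr ℝ ℂ ℂ
  have hsm : ∀ {k : ℝ → ℂ}, LocallyIntegrable k volume → ∀ e : (ℂ × ℂ) →L[ℝ] (ℂ × ℂ),
      LocallyIntegrable (fun x => k x • e) volume := fun hk e =>
    LocallyIntegrable.smul_continuous continuous_const hk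
  have hadd : ∀ {k l : ℝ → (ℂ × ℂ) →L[ℝ] (ℂ × ℂ)}, LocallyIntegrable k volume →
      LocallyIntegrable l volume → LocallyIntegrable (fun x => k x + l x) volume :=
    fun hk hl => locallyIntegrable_fun_add hk hl
  have hA := hadd (hadd (hadd (hsm kuu (inl.comp fst)) (hsm k1 (inl.comp snd)))
    (hsm kvu (inr.comp fst))) (hsm kvv (inr.comp snd))
  have hF : LocallyIntegrable (fun x => ((0 : ℂ), -g x)) volume :=
    hg.mono (aestronglyMeasurable_const.prodMk hg.aestronglyMeasurable.neg) (by simp)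
  obtain ⟨y, hyc, hy⟩ := exists_integral_eq hA hF c (α, β)
  have hloc := (locallyIntegrable_clm_apply hA hyc).add hF
  set f : ℝ → ℂ × ℂ := _ with hf
  change LocallyIntegrable f volume at hloc
  have hf1 : LocallyIntegrable (fun t => (f t).1) volume :=
    hloc.mono (continuous_fst.comp_aestronglyMeasurable hloc.aestronglyMeasurable)
      (Eventually.of_forall fun x => norm_fst_le _)
  have hf2 : LocallyIntegrable (fun t => (f t).2) volume :=
    hloc.mono (continuous_snd.comp_aestronglyMeasurable hloc.aestronglyMeasurable)
      (Eventually.of_forall fun x => norm_snd_le _)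
  have hu : (fun x => (y x).1) = (fun _ => α) + fun x => ∫ t in c..x, (f t).1 := by
    ext x
    have := fst.intervalIntegral_comp_comm (intervalIntegrable_of_locallyIntegrable hloc c x)
    rw [Pi.add_apply, hy x]
    exact congrArg (α + ·) this.symm
  have hv : (fun x => (y x).2) = (fun _ => β) + fun x => ∫ t in c..x, (f t).2 := by
    ext x
    have := snd.intervalIntegral_comp_comm (intervalIntegrable_of_locallyIntegrable hloc c x)
    rw [Pi.add_apply, hy x]
    exact congrArg (β + ·) this.symm
  have hconst : ∀ z : ℂ, ACLoc fun _ => z := fun z => ACLoc.of_contDiff contDiff_const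
  refine ⟨fun x => (y x).1, fun x => (y x).2, ⟨?_, ?_, ?_, ?_⟩, ?_, ?_⟩
  · rw [hu]
    exact (hconst α).add (ACLoc.of_integral hf1 c)
  · rw [hv]
    exact (hconst β).add (ACLoc.of_integral hf2 c)
  · filter_upwards [deriv_integral_ae hf1 c, hc.p_ne_zero] with x hx hp
    have hp' : (p x : ℂ) ≠ 0 := by exact_mod_cast hp
    have hd : HasDerivAt (fun x => (y x).1) (f x).1 x := by
      rw [hu]
      exact hx.const_add α
    rw [quasiDeriv₁, hd.deriv]
    simp [hf, fst, snd, inl, inr]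
    field_simp
    ring
  · filter_upwards [deriv_integral_ae hf2 c, hc.p_ne_zero] with x hx hp
    have hp' : (p x : ℂ) ≠ 0 := by exact_mod_cast hp
    have hd : HasDerivAt (fun x => (y x).2) (f x).2 x := by
      rw [hv]
      exact hx.const_add β
    rw [quasiDeriv₂, hd.deriv]
    simp [hf, fst, snd, inl, inr]
    field_simp
    ring
  · simp [hy c]
  · simp [hy c]

theorem Admissible.deriv_ae_eq {p Q r s : ℝ → ℝ} (hc : Admissible p Q r s) {u v g : ℝ → ℂ}
    (h : IsQuasiSolution p Q r s u v g) :
    deriv u =ᵐ[volume] fun x => (v x + (Q x + Complex.I * r x) * u x) / p x := by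
  filter_upwards [h.quasiDeriv_eq, hc.p_ne_zero] with x hx hp
  have hp' : (p x : ℂ) ≠ 0 := by exact_mod_cast hp
  rw [hx, quasiDeriv₁]
  field_simp
  ring

theorem IsQuasiSolution.deriv_quasiDeriv_ae_eq {p Q r s : ℝ → ℝ} {u v g : ℝ → ℂ}
    (h : IsQuasiSolution p Q r s u v g) :
    deriv v =ᵐ[volume] fun x => -g x - (Q x - Complex.I * r x) / p x * v x -
      (((Q x : ℂ) ^ 2 + (r x : ℂ) ^ 2) / p x - s x) * u x := by
  filter_upwards [h.eq] with x hx
  rw [hx, quasiDeriv₂]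
  ring

/-- The sesquilinear Lagrange bracket. -/
def bracket (u v y z : ℝ → ℂ) (x : ℝ) : ℂ :=
  v x * (starRingEnd ℂ) (y x) - u x * (starRingEnd ℂ) (z x)

/-- Lagrange's identity. -/
theorem Admissible.bracket_sub_bracket {p Q r s : ℝ → ℝ} (hc : Admissible p Q r s)
    {u v g y z h : ℝ → ℂ}
    (hu : IsQuasiSolution p Q r s u v g) (hy : IsQuasiSolution p Q r s y z h) (a b : ℝ) :
    bracket u v y z b - bracket u v y z a =
      ∫ x in a..b, (u x * (starRingEnd ℂ) (h x) - g x * (starRingEnd ℂ) (y x)) := by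
  have hac : ACLoc (bracket u v y z) :=
    (hu.ac_quasiDeriv.mul hy.ac.conj).sub (hu.ac.mul hy.ac_quasiDeriv.conj)
  rw [← hac.integral_deriv a b]
  refine intervalIntegral.integral_congr_ae ?_
  filter_upwards [hc.deriv_ae_eq hu, hc.deriv_ae_eq hy, hu.deriv_quasiDeriv_ae_eq,
    hy.deriv_quasiDeriv_ae_eq, hu.ac.ae_differentiableAt, hy.ac.ae_differentiableAt,
    hu.ac_quasiDeriv.ae_differentiableAt, hy.ac_quasiDeriv.ae_differentiableAt]
    with x e1 e2 e3 e4 d1 d2 d3 d4 _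
  have hd := (d3.hasDerivAt.mul d2.hasDerivAt.star).sub (d1.hasDerivAt.mul d4.hasDerivAt.star)
  have hd' : HasDerivAt (bracket u v y z) _ x := hd
  rw [hd'.deriv, e1, e2, e3, e4]
  simp only [Complex.star_def, map_sub, map_add, map_mul, map_div₀, map_neg, map_pow,
    Complex.conj_ofReal, Complex.conj_I]
  ring

theorem exists_compact_interval {K : Set ℝ} (hK : IsCompact K) : ∃ R : ℝ, 0 < R ∧
    K ⊆ Set.Icc (-R) R := by
  obtain ⟨R, hR⟩ := hK.isBounded.subset_closedBall 0
  refine ⟨max R 1, by positivity, fun x hx => ?_⟩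
  have := hR hx
  rw [Metric.mem_closedBall, Real.dist_eq, sub_zero] at this
  exact abs_le.1 (this.trans (le_max_left _ _))

/-! ### Compactly supported elements and the fundamental system -/

theorem integral_eq_intervalIntegral {E : Type*} [NormedAddCommGroup E] [NormedSpace ℝ E]
    {f : ℝ → E} {R R' : ℝ} (hR : 0 < R) (hRR' : R < R')
    (hf : ∀ᵐ x : ℝ, x ∉ Set.Icc (-R) R → f x = 0) :
    ∫ x, f x = ∫ x in (-R')..R', f x := by
  rw [intervalIntegral.integral_of_le (by linarith),
    setIntegral_eq_integral_of_ae_compl_eq_zero]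
  filter_upwards [hf] with x hx h
  refine hx fun h' => h ⟨by linarith [h'.1], by linarith [h'.2]⟩

theorem mem_compactlySupported_iff {f : L2} :
    f ∈ compactlySupported ↔ ∃ R : ℝ, 0 < R ∧ ∀ᵐ x : ℝ, x ∉ Set.Icc (-R) R → f x = 0 := by
  constructor
  · rintro ⟨u, hu, hf⟩
    obtain ⟨R, hR, hK⟩ := exists_compact_interval hu.isCompact
    refine ⟨R, hR, ?_⟩
    filter_upwards [hf] with x hx h
    rw [hx]
    exact image_eq_zero_of_notMem_tsupport fun h' => h (hK h')
  · rintro ⟨R, hR, h⟩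
    refine ⟨(Set.Icc (-R) R).indicator f, HasCompactSupport.intro isCompact_Icc
      fun x hx => Set.indicator_of_notMem hx _, ?_⟩
    filter_upwards [h] with x hx
    by_cases hm : x ∈ Set.Icc (-R) R
    · rw [Set.indicator_of_mem hm]
    · rw [Set.indicator_of_notMem hm, hx hm]

theorem IsQuasiSolution.eq_zero_of_ae {p Q r s : ℝ → ℝ} {u v g : ℝ → ℂ}
    (h : IsQuasiSolution p Q r s u v g) {U : Set ℝ} (hU : IsOpen U)
    (hu : ∀ᵐ x : ℝ, x ∈ U → u x = 0) :
    (∀ x ∈ U, u x = 0 ∧ v x = 0) ∧ ∀ᵐ x : ℝ, x ∈ U → g x = 0 := by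
  have hu0 : Set.EqOn u (fun _ => 0) U :=
    Measure.eqOn_open_of_ae_eq (μ := volume)
      ((ae_restrict_iff' hU.measurableSet).2 hu) hU h.ac.continuous.continuousOn continuousOn_const
  have hdu : ∀ x ∈ U, deriv u x = 0 := fun x hx => by
    rw [(hu0.eventuallyEq_of_mem (hU.mem_nhds hx)).deriv_eq, deriv_const]
  have hv0 : Set.EqOn v (fun _ => 0) U := by
    refine Measure.eqOn_open_of_ae_eq (μ := volume)
      ((ae_restrict_iff' hU.measurableSet).2 ?_) hU h.ac_quasiDeriv.continuous.continuousOn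
      continuousOn_const
    filter_upwards [h.quasiDeriv_eq] with x hx hxU
    rw [hx, quasiDeriv₁, hdu x hxU, hu0 hxU]
    simp
  have hdv : ∀ x ∈ U, deriv v x = 0 := fun x hx => by
    rw [(hv0.eventuallyEq_of_mem (hU.mem_nhds hx)).deriv_eq, deriv_const]
  refine ⟨fun x hx => ⟨hu0 hx, hv0 hx⟩, ?_⟩
  filter_upwards [h.eq] with x hx hxU
  rw [hx, quasiDeriv₂, hdv x hxU, hu0 hxU, hv0 hxU]
  simp

/-- Green's formula when one of the two functions has compact support. -/
theorem Admissible.integral_mul_conj_eq {p Q r s : ℝ → ℝ} (hc : Admissible p Q r s)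
    {u v g y z h : ℝ → ℂ} (hu : IsQuasiSolution p Q r s u v g)
    (hy : IsQuasiSolution p Q r s y z h) (hg : LocallyIntegrable g volume)
    (hh : LocallyIntegrable h volume) {R : ℝ} (hR : 0 < R)
    (hu0 : ∀ᵐ x : ℝ, x ∉ Set.Icc (-R) R → u x = 0) :
    ∫ x, u x * conj (h x) = ∫ x, g x * conj (y x) := by
  obtain ⟨h1, h2⟩ := hu.eq_zero_of_ae isClosed_Icc.isOpen_compl hu0
  have hlt : R < R + 1 := by linarith
  have hb := hc.bracket_sub_bracket hu hy (-(R + 1)) (R + 1)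
  have e1 : bracket u v y z (R + 1) = 0 := by
    obtain ⟨a, b⟩ := h1 (R + 1) fun h => by linarith [h.2]
    rw [bracket, a, b, zero_mul, zero_mul, sub_zero]
  have e2 : bracket u v y z (-(R + 1)) = 0 := by
    obtain ⟨a, b⟩ := h1 (-(R + 1)) fun h => by linarith [h.1]
    rw [bracket, a, b, zero_mul, zero_mul, sub_zero]
  have hconj : ∀ {f : ℝ → ℂ}, LocallyIntegrable f volume →
      LocallyIntegrable (fun x => conj (f x)) volume := fun hf =>
    hf.mono (Complex.continuous_conj.comp_aestronglyMeasurable hf.aestronglyMeasurable) (by simp)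
  rw [e1, e2, sub_zero, intervalIntegral.integral_sub] at hb
  · rw [integral_eq_intervalIntegral hR hlt, integral_eq_intervalIntegral hR hlt]
    · exact (sub_eq_zero.1 hb.symm)
    · filter_upwards [h2] with x hx hm
      rw [hx hm, zero_mul]
    · filter_upwards [hu0] with x hx hm
      rw [hx hm, zero_mul]
  · exact intervalIntegrable_of_locallyIntegrable
      (LocallyIntegrable.continuous_smul hu.ac.continuous (hconj hh)) _ _
  · exact intervalIntegrable_of_locallyIntegrable
      (LocallyIntegrable.smul_continuous (Complex.continuous_conj.comp hy.ac.continuous) hg) _ _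

theorem locallyIntegrable_L2 (f : L2) : LocallyIntegrable f volume :=
  (Lp.memLp f).locallyIntegrable (by norm_num)

theorem L2_inner_eq (f g : L2) : ⟪f, g⟫_ℂ = ∫ x, g x * conj (f x) := by
  rw [L2.inner_def]
  rfl

/-- Symmetry of the pairing between the maximal operator and its compactly supported part. -/
theorem Admissible.inner_symm {p Q r s : ℝ → ℝ} (hc : Admissible p Q r s) {w f : L2 × L2}
    (hw : w ∈ maxGraph p Q r s) (hw0 : w.1 ∈ compactlySupported) (hf : f ∈ maxGraph p Q r s) :
    ⟪f.2, w.1⟫_ℂ = ⟪f.1, w.2⟫_ℂ := by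
  obtain ⟨u, v, hu, hus⟩ := mem_maxGraph_iff.1 hw
  obtain ⟨y, z, hy, hys⟩ := mem_maxGraph_iff.1 hf
  obtain ⟨R, hR, h0⟩ := mem_compactlySupported_iff.1 hw0
  have h0' : ∀ᵐ x : ℝ, x ∉ Set.Icc (-R) R → u x = 0 := by
    filter_upwards [h0, hu] with x hx e hm
    rw [← e, hx hm]
  have := hc.integral_mul_conj_eq hus hys (locallyIntegrable_L2 _) (locallyIntegrable_L2 _) hR h0'
  rw [L2_inner_eq, L2_inner_eq]
  refine Eq.trans (integral_congr_ae ?_) (this.trans (integral_congr_ae ?_))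
  · filter_upwards [hu] with x hx
    rw [hx]
  · filter_upwards [hy] with x hx
    rw [hx]

/-- A fundamental system of solutions of `l[y] = 0`, together with the nondegeneracy of the
Lagrange bracket against it. -/
theorem Admissible.exists_fundamental {p Q r s : ℝ → ℝ} (hc : Admissible p Q r s) :
    ∃ y₁ z₁ y₂ z₂ : ℝ → ℂ, IsQuasiSolution p Q r s y₁ z₁ 0 ∧ IsQuasiSolution p Q r s y₂ z₂ 0 ∧
      ∀ (u v : ℝ → ℂ) (x : ℝ), bracket u v y₁ z₁ x = 0 → bracket u v y₂ z₂ x = 0 →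
        u x = 0 ∧ v x = 0 := by
  have h0 : LocallyIntegrable (0 : ℝ → ℂ) volume := locallyIntegrable_zero
  obtain ⟨y₁, z₁, h₁, a₁, b₁⟩ := hc.exists_isQuasiSolution h0 0 1 0
  obtain ⟨y₂, z₂, h₂, a₂, b₂⟩ := hc.exists_isQuasiSolution h0 0 0 1
  refine ⟨y₁, z₁, y₂, z₂, h₁, h₂, fun u v x e₁ e₂ => ?_⟩
  have k11 := hc.bracket_sub_bracket h₁ h₁ 0 x
  have k12 := hc.bracket_sub_bracket h₁ h₂ 0 x
  have k21 := hc.bracket_sub_bracket h₂ h₁ 0 x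
  have k22 := hc.bracket_sub_bracket h₂ h₂ 0 x
  simp only [bracket, a₁, b₁, a₂, b₂, Pi.zero_apply, map_zero, map_one, mul_zero, zero_mul,
    mul_one, sub_zero, zero_sub, sub_neg_eq_add, intervalIntegral.integral_zero] at k11 k12 k21 k22 e₁ e₂
  have hdet : (y₁ x * z₂ x - z₁ x * y₂ x) * (conj (y₁ x) * conj (z₂ x) - conj (z₁ x) * conj (y₂ x))
      = 1 := by
    linear_combination (z₂ x * conj (y₂ x) - y₂ x * conj (z₂ x)) * k11 -
      (z₂ x * conj (y₁ x) - y₂ x * conj (z₁ x)) * k12 + k21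
  have hne := right_ne_zero_of_mul_eq_one hdet
  constructor
  · refine (mul_eq_zero.1 (?_ : u x * (conj (y₁ x) * conj (z₂ x) - conj (z₁ x) * conj (y₂ x)) = 0)
      ).resolve_right hne
    linear_combination conj (y₂ x) * e₁ - conj (y₁ x) * e₂
  · refine (mul_eq_zero.1 (?_ : v x * (conj (y₁ x) * conj (z₂ x) - conj (z₁ x) * conj (y₂ x)) = 0)
      ).resolve_right hne
    linear_combination conj (z₂ x) * e₁ - conj (z₁ x) * e₂

/-- A compactly supported right-hand side orthogonal to the solutions of the homogeneous equation
is attained on a compactly supported function. -/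
theorem Admissible.exists_compactlySupported_solution {p Q r s : ℝ → ℝ} (hc : Admissible p Q r s)
    {y₁ z₁ y₂ z₂ : ℝ → ℂ} (h₁ : IsQuasiSolution p Q r s y₁ z₁ 0)
    (h₂ : IsQuasiSolution p Q r s y₂ z₂ 0)
    (hnd : ∀ (u v : ℝ → ℂ) (x : ℝ), bracket u v y₁ z₁ x = 0 → bracket u v y₂ z₂ x = 0 →
        u x = 0 ∧ v x = 0)
    {h : ℝ → ℂ} (hh : LocallyIntegrable h volume) {R : ℝ}
    (h0 : ∀ᵐ x : ℝ, x ∉ Set.Icc (-R) R → h x = 0)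
    (o₁ : ∫ x, h x * conj (y₁ x) = 0) (o₂ : ∫ x, h x * conj (y₂ x) = 0) :
    ∃ u v, IsQuasiSolution p Q r s u v h ∧ ∀ x, x ∉ Set.Icc (-(R + 1)) (R + 1) → u x = 0 := by
  obtain ⟨u, v, hu, hua, hva⟩ := hc.exists_isQuasiSolution hh (-(R + 1)) 0 0
  refine ⟨u, v, hu, fun x hx => ?_⟩
  have key : ∀ {y z : ℝ → ℂ}, IsQuasiSolution p Q r s y z 0 → ∫ x, h x * conj (y x) = 0 →
      bracket u v y z x = 0 := by
    intro y z hy ho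
    have hb := hc.bracket_sub_bracket hu hy (-(R + 1)) x
    have e1 : bracket u v y z (-(R + 1)) = 0 := by
      rw [bracket, hua, hva, zero_mul, zero_mul, sub_zero]
    rw [e1, sub_zero] at hb
    rw [hb]
    simp only [Pi.zero_apply, map_zero, mul_zero, zero_sub, intervalIntegral.integral_neg,
      neg_eq_zero]
    rcases le_or_gt x (-(R + 1)) with hle | hgt
    · refine (intervalIntegral.integral_congr_ae (g := fun _ => 0) ?_).trans (by simp)
      filter_upwards [h0] with t ht hm
      rw [Set.uIoc_of_ge hle] at hm
      rw [ht fun h => by linarith [hm.2, h.1], zero_mul]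
    · have hgt' : R + 1 < x := by
        by_contra hcon
        exact hx ⟨hgt.le, not_lt.1 hcon⟩
      rw [intervalIntegral.integral_of_le hgt.le, setIntegral_eq_integral_of_ae_compl_eq_zero, ho]
      filter_upwards [h0] with t ht hm
      rw [ht fun h' => hm ⟨by linarith [h'.1], by linarith [h'.2]⟩, zero_mul]
  exact (hnd u v x (key h₁ o₁) (key h₂ o₂)).1

/-! ### The adjoint of the preminimal operator -/

/-- Complex-valued functions that are square integrable on compact sets. -/
def MemL2LocC (F : ℝ → ℂ) : Prop :=
  ∀ K : Set ℝ, IsCompact K → MemLp F 2 (volume.restrict K)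

theorem MemL2LocC.of_continuous {F : ℝ → ℂ} (hF : Continuous F) : MemL2LocC F := fun K hK => by
  have : IsFiniteMeasure (volume.restrict K) := ⟨by simpa using hK.measure_lt_top⟩
  obtain ⟨C, hC⟩ := hK.exists_bound_of_continuousOn hF.continuousOn
  exact MemLp.of_bound hF.aestronglyMeasurable C
    ((ae_restrict_iff' hK.measurableSet).2 (Eventually.of_forall hC))

theorem MemL2LocC.of_memLp {F : ℝ → ℂ} (hF : MemLp F 2 volume) : MemL2LocC F :=
  fun K _ => hF.restrict K

theorem MemL2LocC.sub {F G : ℝ → ℂ} (hF : MemL2LocC F) (hG : MemL2LocC G) :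
    MemL2LocC (fun x => F x - G x) :=
  fun K hK => (hF K hK).sub (hG K hK)

theorem integrable_mul_conj {F : ℝ → ℂ} (hF : MemL2LocC F) {h : L2} (hh : h ∈ compactlySupported) :
    Integrable (fun x => h x * conj (F x)) volume := by
  obtain ⟨R, hR, h0⟩ := mem_compactlySupported_iff.1 hh
  have h1 : IntegrableOn (fun x => h x * conj (F x)) (Set.Icc (-R) R) volume :=
    ((Lp.memLp h).restrict _).integrable_mul (hF _ isCompact_Icc).star
  refine ((integrable_indicator_iff measurableSet_Icc).2 h1).congr ?_
  filter_upwards [h0] with x hx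
  by_cases hm : x ∈ Set.Icc (-R) R
  · rw [Set.indicator_of_mem hm]
  · rw [Set.indicator_of_notMem hm, hx hm, zero_mul]

/-- The linear functional `h ↦ ∫ h F̄` on compactly supported elements. -/
def pairing (F : ℝ → ℂ) (hF : MemL2LocC F) : compactlySupported →ₗ[ℂ] ℂ where
  toFun h := ∫ x, (h : L2) x * conj (F x)
  map_add' h k := by
    rw [← integral_add (integrable_mul_conj hF h.2) (integrable_mul_conj hF k.2)]
    refine integral_congr_ae ?_
    filter_upwards [Lp.coeFn_add (h : L2) (k : L2)] with x hx
    rw [Submodule.coe_add, hx, Pi.add_apply, add_mul]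
  map_smul' c h := by
    rw [RingHom.id_apply, smul_eq_mul, ← integral_const_mul]
    refine integral_congr_ae ?_
    filter_upwards [Lp.coeFn_smul c (h : L2)] with x hx
    rw [Submodule.coe_smul, hx, Pi.smul_apply, smul_eq_mul, mul_assoc]

theorem ae_eq_zero_of_pairing {F : ℝ → ℂ} (hF : MemL2LocC F) (h : pairing F hF = 0) :
    F =ᵐ[volume] 0 := by
  have key : ∀ n : ℕ, ∀ᵐ x : ℝ, x ∈ Set.Icc (-(n : ℝ) - 1) (n + 1) → F x = 0 := by
    intro n
    set I := Set.Icc (-(n : ℝ) - 1) (n + 1) with hI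
    have hm : MemLp (I.indicator F) 2 volume :=
      (memLp_indicator_iff_restrict measurableSet_Icc).2 (hF _ isCompact_Icc)
    have hcs : hm.toLp _ ∈ compactlySupported := ⟨I.indicator F,
      HasCompactSupport.intro isCompact_Icc fun x hx => Set.indicator_of_notMem hx _,
      hm.coeFn_toLp⟩
    have h1 := LinearMap.congr_fun h ⟨_, hcs⟩
    have h2 : ∫ x in I, ((‖F x‖ ^ 2 : ℝ) : ℂ) = 0 := by
      rw [← integral_indicator measurableSet_Icc]
      refine Eq.trans (integral_congr_ae ?_) h1
      filter_upwards [hm.coeFn_toLp] with x hx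
      change _ = (hm.toLp _ : L2) x * conj (F x)
      rw [hx]
      by_cases hxI : x ∈ I
      · rw [Set.indicator_of_mem hxI, Set.indicator_of_mem hxI, Complex.mul_conj,
          Complex.normSq_eq_norm_sq]
      · rw [Set.indicator_of_notMem hxI, Set.indicator_of_notMem hxI, zero_mul]
    rw [integral_complex_ofReal, Complex.ofReal_eq_zero, integral_eq_zero_iff_of_nonneg
      (fun x => by positivity) (hF _ isCompact_Icc).integrable_norm_pow'] at h2
    have h3 := (ae_restrict_iff' measurableSet_Icc).1 h2
    filter_upwards [h3] with x hx hxI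
    simpa using hx hxI
  filter_upwards [ae_all_iff.2 key] with x hx
  obtain ⟨n, hn⟩ := exists_nat_ge |x|
  have := abs_le.1 hn
  exact hx n ⟨by linarith, by linarith⟩

theorem Admissible.mem_maxGraph_of_inner_symm {p Q r s : ℝ → ℝ} (hc : Admissible p Q r s)
    {f : L2 × L2} (hf : ∀ w ∈ maxGraph p Q r s, w.1 ∈ compactlySupported →
      ⟪f.2, w.1⟫_ℂ = ⟪f.1, w.2⟫_ℂ) : f ∈ maxGraph p Q r s := by
  obtain ⟨u₀, v₀, hu₀, -, -⟩ := hc.exists_isQuasiSolution (locallyIntegrable_L2 f.2) 0 0 0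
  obtain ⟨y₁, z₁, y₂, z₂, h₁, h₂, hnd⟩ := hc.exists_fundamental
  have m₀ := (MemL2LocC.of_memLp (Lp.memLp f.1)).sub (MemL2LocC.of_continuous hu₀.ac.continuous)
  have m₁ := MemL2LocC.of_continuous h₁.ac.continuous
  have m₂ := MemL2LocC.of_continuous h₂.ac.continuous
  have hker : ⨅ i, LinearMap.ker ((![pairing y₁ m₁, pairing y₂ m₂]) i) ≤
      LinearMap.ker (pairing _ m₀) := by
    intro h hh
    rw [Submodule.mem_iInf] at hh
    have o₁ : ∫ x, (h : L2) x * conj (y₁ x) = 0 := hh 0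
    have o₂ : ∫ x, (h : L2) x * conj (y₂ x) = 0 := hh 1
    obtain ⟨R, hR, h0⟩ := mem_compactlySupported_iff.1 h.2
    obtain ⟨w, v, hw, hw0⟩ := hc.exists_compactlySupported_solution h₁ h₂ hnd
      (locallyIntegrable_L2 (h : L2)) h0 o₁ o₂
    have hwc : HasCompactSupport w := HasCompactSupport.intro isCompact_Icc hw0
    have hwm : MemLp w 2 volume := hw.ac.continuous.memLp_of_hasCompactSupport hwc
    have hin := hf (hwm.toLp w, h) (mem_maxGraph_iff.2 ⟨w, v, hwm.coeFn_toLp, hw⟩)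
      ⟨w, hwc, hwm.coeFn_toLp⟩
    rw [L2_inner_eq, L2_inner_eq] at hin
    have hg := hc.integral_mul_conj_eq hw hu₀ (locallyIntegrable_L2 (h : L2))
      (locallyIntegrable_L2 f.2) (by linarith : 0 < R + 1) (Eventually.of_forall hw0)
    have hin' : ∫ x, w x * conj (f.2 x) = ∫ x, (h : L2) x * conj (f.1 x) := by
      rw [← hin]
      refine integral_congr_ae ?_
      filter_upwards [hwm.coeFn_toLp] with x hx
      rw [hx]
    rw [LinearMap.mem_ker]
    change ∫ x, (h : L2) x * conj (f.1 x - u₀ x) = 0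
    simp only [map_sub, mul_sub]
    rw [integral_sub (integrable_mul_conj (MemL2LocC.of_memLp (Lp.memLp f.1)) h.2)
      (integrable_mul_conj (MemL2LocC.of_continuous hu₀.ac.continuous) h.2), ← hin', hg, sub_self]
  obtain ⟨c, hcs⟩ := (Submodule.mem_span_range_iff_exists_fun ℂ).1
    (mem_span_of_iInf_ker_le_ker hker)
  rw [Fin.sum_univ_two] at hcs
  have hcomb : IsQuasiSolution p Q r s (conj (c 0) • y₁ + conj (c 1) • y₂ + u₀)
      (conj (c 0) • z₁ + conj (c 1) • z₂ + v₀) (conj (c 0) • 0 + conj (c 1) • 0 + f.2) :=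
    ((h₁.smul _).add (h₂.smul _)).add hu₀
  have m := m₀.sub (MemL2LocC.of_continuous ((h₁.smul (conj (c 0))).add
    (h₂.smul (conj (c 1)))).ac.continuous)
  have hz : pairing _ m = 0 := by
    ext h
    have e := LinearMap.congr_fun hcs h
    change c 0 * (∫ x, (h : L2) x * conj (y₁ x)) + c 1 * (∫ x, (h : L2) x * conj (y₂ x)) =
      ∫ x, (h : L2) x * conj (f.1 x - u₀ x) at e
    change ∫ x, (h : L2) x * conj (f.1 x - u₀ x - (conj (c 0) * y₁ x + conj (c 1) * y₂ x)) = 0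
    have i₁ := (integrable_mul_conj m₁ h.2).const_mul (c 0)
    have i₂ := (integrable_mul_conj m₂ h.2).const_mul (c 1)
    rw [← integral_const_mul, ← integral_const_mul, ← integral_add i₁ i₂] at e
    rw [← sub_eq_zero.2 e.symm]
    refine Eq.trans (integral_congr_ae (Eventually.of_forall fun x => ?_))
      (integral_sub (integrable_mul_conj m₀ h.2) (i₁.add i₂))
    simp only [map_sub, map_add, map_mul, Complex.conj_conj]
    ring
  refine mem_maxGraph_iff.2 ⟨_, _, ?_, hcomb.congr (by simp)⟩
  filter_upwards [ae_eq_zero_of_pairing m hz] with x hx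
  simp only [Pi.zero_apply, Pi.add_apply] at hx ⊢
  linear_combination hx

theorem mem_graph_preminOp_iff {p Q r s : ℝ → ℝ} {w : L2 × L2} :
    w ∈ (preminOp p Q r s).graph ↔ w ∈ maxGraph p Q r s ∧ w.1 ∈ compactlySupported := by
  rw [← graph_maxOp, LinearPMap.mem_graph_iff, LinearPMap.mem_graph_iff]
  constructor
  · rintro ⟨y, hy, hw⟩
    exact ⟨⟨⟨y, y.2.2⟩, hy, hw⟩, hy ▸ y.2.1⟩
  · rintro ⟨⟨y, hy, hw⟩, h⟩
    exact ⟨⟨y, hy ▸ h, y.2⟩, hy, hw⟩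

theorem preminOp_le_maxOp (p Q r s : ℝ → ℝ) : preminOp p Q r s ≤ maxOp p Q r s :=
  LinearPMap.domRestrict_le

theorem Admissible.dense_domain_preminOp {p Q r s : ℝ → ℝ} (hc : Admissible p Q r s) :
    Dense ((preminOp p Q r s).domain : Set L2) := by
  rw [Submodule.dense_iff_topologicalClosure_eq_top, Submodule.topologicalClosure_eq_top_iff,
    Submodule.eq_bot_iff]
  intro g hg
  have h : ((0 : L2), g) ∈ maxGraph p Q r s := by
    refine hc.mem_maxGraph_of_inner_symm fun w hw hw0 => ?_
    rw [inner_zero_left]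
    refine (Submodule.mem_orthogonal' _ _).1 hg _ ?_
    obtain ⟨y, hy, -⟩ := (LinearPMap.mem_graph_iff _).1 (mem_graph_preminOp_iff.2 ⟨hw, hw0⟩)
    exact hy ▸ y.2
  exact maxGraph_functional p Q r s _ h rfl

theorem Admissible.adjoint_preminOp {p Q r s : ℝ → ℝ} (hc : Admissible p Q r s) :
    (preminOp p Q r s)† = maxOp p Q r s := by
  apply LinearPMap.eq_of_eq_graph
  rw [LinearPMap.adjoint_graph_eq_graph_adjoint hc.dense_domain_preminOp, graph_maxOp]
  ext f
  rw [Submodule.mem_adjoint_iff]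
  constructor
  · intro h
    refine hc.mem_maxGraph_of_inner_symm fun w hw hw0 => ?_
    have := sub_eq_zero.1 (h w.1 w.2 (mem_graph_preminOp_iff.2 ⟨hw, hw0⟩))
    rw [← inner_conj_symm, ← this, inner_conj_symm]
  · intro h a b hab
    obtain ⟨hw, hw0⟩ := mem_graph_preminOp_iff.1 hab
    have := hc.inner_symm hw hw0 h
    rw [sub_eq_zero, ← inner_conj_symm, ← this, inner_conj_symm]

/-! ### Localized products with a `W¹₂` function -/

theorem memLp_mul_continuous_restrict {f θ : ℝ → ℝ} {a b : ℝ}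
    (hf : MemLp f 2 (volume.restrict (Set.Icc a b))) (hθ : Continuous θ) :
    MemLp (fun x => f x * θ x) 2 (volume.restrict (Set.Icc a b)) := by
  obtain ⟨C, hC⟩ := (isCompact_Icc (a := a) (b := b)).exists_bound_of_continuousOn
    hθ.continuousOn
  refine hf.of_le_mul (c := C) (hf.aestronglyMeasurable.mul hθ.aestronglyMeasurable)
    ((ae_restrict_iff' measurableSet_Icc).2 (Eventually.of_forall fun x hx => ?_))
  rw [norm_mul, mul_comm]
  exact mul_le_mul_of_nonneg_right (hC x hx) (norm_nonneg _)

theorem contDiff_primitive_and_deriv {χ : ℝ → ℝ} (hχ : ContDiff ℝ ∞ χ) (b : ℝ) :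
    ContDiff ℝ ∞ (fun x => ∫ t in b..x, χ t) ∧ deriv (fun x => ∫ t in b..x, χ t) = χ := by
  have hd : ∀ x, HasDerivAt (fun x => ∫ t in b..x, χ t) (χ x) x := fun x =>
    intervalIntegral.integral_hasDerivAt_right (hχ.continuous.intervalIntegrable _ _)
      hχ.continuous.stronglyMeasurable.stronglyMeasurableAtFilter hχ.continuous.continuousAt
  have he : deriv (fun x => ∫ t in b..x, χ t) = χ := funext fun x => (hd x).deriv
  exact ⟨contDiff_infty_iff_deriv.2 ⟨fun x => (hd x).differentiableAt, by rwa [he]⟩, he⟩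

/-- If `p ∈ W¹₂(a, b)` and `θ` is smooth with support inside `(a, b)`, then `p θ` has an absolutely
continuous version whose derivative is in `L²`. -/
theorem MemW12.exists_mul_version {p θ : ℝ → ℝ} {a b : ℝ} (hab : a < b) (hp : MemW12 p a b)
    (hθ : ContDiff ℝ ∞ θ) (hsupp : tsupport θ ⊆ Set.Ioo a b) :
    ∃ P : ℝ → ℝ, (∀ c d, AbsolutelyContinuousOnInterval P c d) ∧
      (P =ᵐ[volume] fun x => p x * θ x) ∧ MemLp (deriv P) 2 volume := by
  obtain ⟨hp2, g, hg2, hweak⟩ := hp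
  have hθ' : ContDiff ℝ ∞ (deriv θ) := (contDiff_infty_iff_deriv.1 hθ).2
  have hθ0 : ∀ x, x ∉ Set.Ioo a b → θ x = 0 := fun x hx =>
    image_eq_zero_of_notMem_tsupport fun h => hx (hsupp h)
  have hcomp : ∀ Ψ : ℝ → ℝ, HasCompactSupport fun x => θ x * Ψ x := fun Ψ =>
    HasCompactSupport.intro (isCompact_Icc (a := a) (b := b)) fun x hx => by
      rw [hθ0 x fun h => hx (Set.Ioo_subset_Icc_self h), zero_mul]
  set G₀ : ℝ → ℝ := fun x => g x * θ x + p x * deriv θ x with hG₀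
  have hG₀2 : MemLp G₀ 2 (volume.restrict (Set.Icc a b)) :=
    (memLp_mul_continuous_restrict hg2 hθ.continuous).add
      (memLp_mul_continuous_restrict hp2 hθ'.continuous)
  set G : ℝ → ℝ := (Set.Icc a b).indicator G₀ with hG
  have hG2 : MemLp G 2 volume := (memLp_indicator_iff_restrict measurableSet_Icc).2 hG₀2
  have hGloc : LocallyIntegrable G volume := hG2.locallyIntegrable (by norm_num)
  have hInt : ∀ {f η : ℝ → ℝ}, MemLp f 2 (volume.restrict (Set.Icc a b)) → Continuous η →
      IntegrableOn (fun x => f x * η x) (Set.Icc a b) volume := fun hf hη =>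
    (memLp_mul_continuous_restrict hf hη).integrable (by norm_num)
  have key : ∀ Ψ : ℝ → ℝ, ContDiff ℝ ∞ Ψ →
      ∫ x in Set.Icc a b, p x * (θ x * deriv Ψ x) = -∫ x in Set.Icc a b, G₀ x * Ψ x := by
    intro Ψ hΨ
    have hΨ' : Continuous (deriv Ψ) := (contDiff_infty_iff_deriv.1 hΨ).2.continuous
    have h := hweak (fun x => θ x * Ψ x) (hθ.mul hΨ) (hcomp Ψ)
      ((tsupport_mul_subset_left (f := θ) (g := Ψ)).trans hsupp)
    have hd : ∀ x, deriv (fun x => θ x * Ψ x) x = deriv θ x * Ψ x + θ x * deriv Ψ x := fun x =>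
      deriv_fun_mul ((hθ.differentiable (by simp)) x) ((hΨ.differentiable (by simp)) x)
    simp only [hd, mul_add] at h
    rw [integral_add (hInt (η := fun x => deriv θ x * Ψ x) hp2 (hθ'.continuous.mul hΨ.continuous))
      (hInt (η := fun x => θ x * deriv Ψ x) hp2 (hθ.continuous.mul hΨ'))] at h
    have h2 : ∫ x in Set.Icc a b, G₀ x * Ψ x = (∫ x in Set.Icc a b, g x * (θ x * Ψ x)) +
        ∫ x in Set.Icc a b, p x * (deriv θ x * Ψ x) := by
      rw [← integral_add (hInt (η := fun x => θ x * Ψ x) hg2 (hθ.continuous.mul hΨ.continuous))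
        (hInt (η := fun x => deriv θ x * Ψ x) hp2 (hθ'.continuous.mul hΨ.continuous))]
      refine integral_congr_ae (Eventually.of_forall fun x => ?_)
      simp only [hG₀]
      ring
    rw [h2]
    linarith
  set P : ℝ → ℝ := fun x => ∫ t in a..x, G t with hP
  have hPac : ∀ c d, AbsolutelyContinuousOnInterval P c d :=
    absolutelyContinuousOnInterval_integral hGloc a
  have hPc : Continuous P := intervalIntegral.continuous_primitive
    (intervalIntegrable_of_locallyIntegrable hGloc) a
  have hPd : ∀ᵐ x : ℝ, deriv P x = G x := (deriv_integral_ae hGloc a).mono fun x hx => hx.deriv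
  have hG0 : ∀ x, x ∉ Set.Icc a b → G x = 0 := fun x hx => Set.indicator_of_notMem hx _
  have hPa : P a = 0 := by simp [hP]
  have hGi : ∫ x in Set.Icc a b, G₀ x = 0 := by
    have := key (fun _ => 1) contDiff_const
    simpa using this
  have hP0 : ∀ x, x ∉ Set.Icc a b → P x = 0 := by
    intro x hx
    rcases lt_or_ge x a with h | h
    · refine (intervalIntegral.integral_congr_ae (g := fun _ => 0) ?_).trans (by simp)
      filter_upwards [compl_mem_ae_iff.2 (measure_singleton a)] with t hta ht
      rw [Set.uIoc_of_ge h.le] at ht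
      exact hG0 t fun h' => hta (le_antisymm ht.2 h'.1)
    · have hbx : b < x := by
        by_contra hcon
        exact hx ⟨h, not_lt.1 hcon⟩
      simp only [hP]
      rw [intervalIntegral.integral_of_le h, ← integral_Icc_eq_integral_Ioc,
        setIntegral_eq_integral_of_forall_compl_eq_zero, hG, integral_indicator measurableSet_Icc,
        hGi]
      intro t ht
      exact hG0 t fun h' => ht ⟨h'.1, h'.2.trans hbx.le⟩
  have hpθ : Integrable (fun x => p x * θ x) volume := by
    refine ((integrable_indicator_iff measurableSet_Icc).2 (hInt hp2 hθ.continuous)).congr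
      (Eventually.of_forall fun x => ?_)
    by_cases hx : x ∈ Set.Icc a b
    · simp only [Set.indicator_of_mem hx]
    · simp only [Set.indicator_of_notMem hx, hθ0 x fun h => hx (Set.Ioo_subset_Icc_self h),
        mul_zero]
  refine ⟨P, hPac, ?_, hG2.ae_eq (hPd.mono fun x hx => hx.symm)⟩
  have hz : ∀ᵐ x : ℝ, P x - p x * θ x = 0 := by
    refine ae_eq_zero_of_integral_contDiff_smul_eq_zero
      (hPc.locallyIntegrable.sub hpθ.locallyIntegrable) fun χ hχ hχc => ?_
    obtain ⟨hΨ, hΨd⟩ := contDiff_primitive_and_deriv hχ b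
    set Ψ : ℝ → ℝ := fun x => ∫ t in b..x, χ t with hΨdef
    have hΨb : Ψ b = 0 := by simp [hΨdef]
    have e1 : ∫ x, χ x * P x = -∫ x in Set.Icc a b, G₀ x * Ψ x := by
      have h1 : ∫ x, χ x * P x = ∫ x in a..b, P x * deriv Ψ x := by
        rw [hΨd, intervalIntegral.integral_of_le hab.le, ← integral_Icc_eq_integral_Ioc,
          setIntegral_eq_integral_of_forall_compl_eq_zero]
        · simp only [mul_comm]
        · intro x hx
          rw [hP0 x hx, zero_mul]
      rw [h1, (hPac a b).integral_mul_deriv_eq_deriv_mul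
        (hΨ.of_le (by simp)).contDiffOn.absolutelyContinuousOnInterval, hPa, hΨb, mul_zero,
        zero_mul, sub_zero, zero_sub, intervalIntegral.integral_of_le hab.le,
        ← integral_Icc_eq_integral_Ioc]
      congr 1
      refine setIntegral_congr_ae measurableSet_Icc ?_
      filter_upwards [hPd] with x hx hm
      rw [hx, hG, Set.indicator_of_mem hm]
    have e2 : ∫ x, χ x * (p x * θ x) = -∫ x in Set.Icc a b, G₀ x * Ψ x := by
      rw [← key Ψ hΨ, hΨd, setIntegral_eq_integral_of_forall_compl_eq_zero]
      · refine integral_congr_ae (Eventually.of_forall fun x => ?_)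
        ring
      · intro x hx
        rw [hθ0 x fun h => hx (Set.Ioo_subset_Icc_self h), zero_mul, mul_zero]
    have i1 : Integrable (fun x => χ x * P x) volume :=
      (hχ.continuous.mul hPc).integrable_of_hasCompactSupport hχc.mul_right
    have i2 : Integrable (fun x => χ x * (p x * θ x)) volume := by
      obtain ⟨C, hC⟩ := hχc.exists_bound_of_continuous hχ.continuous
      exact hpθ.bdd_mul hχ.continuous.aestronglyMeasurable (Eventually.of_forall hC)
    simp only [smul_eq_mul, mul_sub]
    rw [integral_sub i1 i2, e1, e2, sub_self]
  filter_upwards [hz] with x hx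
  exact sub_eq_zero.1 hx

/-! ### Cutting off a solution -/

theorem ae_differentiableAt_of_absolutelyContinuous {P : ℝ → ℝ}
    (hP : ∀ c d, AbsolutelyContinuousOnInterval P c d) : ∀ᵐ x : ℝ, DifferentiableAt ℝ P x := by
  have h : LocallyBoundedVariationOn P Set.univ := by
    intro a b _ _
    rw [Set.univ_inter]
    exact (hP a b).boundedVariationOn.mono Set.Icc_subset_uIcc
  exact h.ae_differentiableAt

theorem continuous_of_absolutelyContinuous {P : ℝ → ℝ}
    (hP : ∀ c d, AbsolutelyContinuousOnInterval P c d) : Continuous P := by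
  exact Complex.continuous_re.comp (ACLoc.ofReal hP).continuous

theorem absolutelyContinuous_of_contDiff {φ : ℝ → ℝ} (hφ : ContDiff ℝ ∞ φ) (c d : ℝ) :
    AbsolutelyContinuousOnInterval φ c d :=
  (hφ.of_le (by simp)).contDiffOn.absolutelyContinuousOnInterval

theorem Admissible.isQuasiSolution_cutoff {p Q r s : ℝ → ℝ} (hc : Admissible p Q r s)
    {u v g : ℝ → ℂ} (hu : IsQuasiSolution p Q r s u v g) {φ P : ℝ → ℝ} (hφ : ContDiff ℝ ∞ φ)
    (hP : ∀ c d, AbsolutelyContinuousOnInterval P c d)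
    (hPe : P =ᵐ[volume] fun x => p x * deriv φ x) :
    IsQuasiSolution p Q r s (fun x => φ x * u x) (fun x => φ x * v x + P x * u x)
      (fun x => φ x * g x - 2 * deriv φ x * (v x + Q x * u x) - deriv P x * u x) := by
  have hφac := ACLoc.ofReal (absolutelyContinuous_of_contDiff hφ)
  have hPac := ACLoc.ofReal hP
  have hφd : ∀ x, HasDerivAt (fun x => (φ x : ℂ)) ((deriv φ x : ℝ) : ℂ) x := fun x =>
    ((hφ.differentiable (by simp)) x).hasDerivAt.ofReal_comp
  refine ⟨hφac.mul hu.ac, (hφac.mul hu.ac_quasiDeriv).add (hPac.mul hu.ac), ?_, ?_⟩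
  · filter_upwards [hu.quasiDeriv_eq, hu.ac.ae_differentiableAt, hPe] with x e d hx
    rw [quasiDeriv₁, ((hφd x).fun_mul d.hasDerivAt).deriv, e, quasiDeriv₁, hx]
    push_cast
    ring
  · filter_upwards [hu.eq, hc.deriv_ae_eq hu, hu.ac.ae_differentiableAt,
      hu.ac_quasiDeriv.ae_differentiableAt, hPe, ae_differentiableAt_of_absolutelyContinuous hP,
      hc.p_ne_zero] with x e e' d d' hx hPd hp
    have hp' : (p x : ℂ) ≠ 0 := by exact_mod_cast hp
    have hx' : (P x : ℂ) = p x * deriv φ x := by exact_mod_cast hx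
    rw [quasiDeriv₂, (((hφd x).fun_mul d'.hasDerivAt).fun_add
      (hPd.hasDerivAt.ofReal_comp.fun_mul d.hasDerivAt)).deriv, e, quasiDeriv₂, e', hx']
    field_simp
    ring

/-- The pointwise energy identity for a truncated eigenfunction. -/
theorem Admissible.cutoff_energy_ae {p Q r s : ℝ → ℝ} (hc : Admissible p Q r s)
    {u v g : ℝ → ℂ} (hu : IsQuasiSolution p Q r s u v g) {l : ℝ}
    (hg : g =ᵐ[volume] fun x => l * u x) {φ P : ℝ → ℝ} (hφ : ContDiff ℝ ∞ φ)
    (hP : ∀ c d, AbsolutelyContinuousOnInterval P c d)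
    (hPe : P =ᵐ[volume] fun x => p x * deriv φ x) :
    ∀ᵐ x : ℝ, ((φ x * g x - 2 * deriv φ x * (v x + Q x * u x) - deriv P x * u x) *
        conj (φ x * u x)).re =
      l * (φ x ^ 2 * ‖u x‖ ^ 2) + deriv φ x * P x * ‖u x‖ ^ 2 -
        (deriv (fun x => φ x * P x * (u x * conj (u x))) x).re := by
  have hφd : ∀ x, HasDerivAt (fun x => (φ x : ℂ)) ((deriv φ x : ℝ) : ℂ) x := fun x =>
    ((hφ.differentiable (by simp)) x).hasDerivAt.ofReal_comp
  filter_upwards [hg, hc.deriv_ae_eq hu, hu.ac.ae_differentiableAt, hPe,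
    ae_differentiableAt_of_absolutelyContinuous hP, hc.p_ne_zero] with x eg e' d hx hPd hp
  have hp' : (p x : ℂ) ≠ 0 := by exact_mod_cast hp
  have hx' : (P x : ℂ) = p x * deriv φ x := by exact_mod_cast hx
  have hd := ((hφd x).fun_mul hPd.hasDerivAt.ofReal_comp).fun_mul
    (d.hasDerivAt.fun_mul d.hasDerivAt.star)
  have hN : ((‖u x‖ ^ 2 : ℝ) : ℂ) = u x * conj (u x) := by
    rw [Complex.mul_conj, Complex.normSq_eq_norm_sq]
  have hPu : (P x : ℂ) * deriv u x = deriv φ x * (v x + (Q x + Complex.I * r x) * u x) := by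
    rw [e', hx']
    field_simp
  have hPu' : (P x : ℂ) * conj (deriv u x) =
      deriv φ x * (conj (v x) + (Q x - Complex.I * r x) * conj (u x)) := by
    have := congrArg conj hPu
    simpa [sub_eq_add_neg] using this
  rw [show deriv (fun x => (φ x : ℂ) * P x * (u x * conj (u x))) x = _ from hd.deriv, eg]
  simp only [Complex.star_def]
  set D := deriv u x
  set w := ((φ x : ℂ) * (l * u x) - 2 * deriv φ x * (v x + Q x * u x) - deriv P x * u x) *
        conj (φ x * u x) with hw
  set N := (((deriv φ x : ℝ) : ℂ) * P x + φ x * deriv P x) * (u x * conj (u x)) +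
    φ x * P x * (D * conj (u x) + u x * conj D) with hNdef
  have h1 : w + conj w = 2 * ((l * (φ x ^ 2 * ‖u x‖ ^ 2) + deriv φ x * P x * ‖u x‖ ^ 2 : ℝ) : ℂ)
      - (N + conj N) := by
    push_cast at hN ⊢
    rw [hN]
    simp only [hw, hNdef, map_sub, map_add, map_mul, Complex.conj_ofReal, Complex.conj_conj,
      map_ofNat]
    linear_combination (2 * φ x * conj (u x)) * hPu + (2 * φ x * u x) * hPu'
  rw [Complex.add_conj, Complex.add_conj] at h1
  have h2 := congrArg Complex.re h1
  simp only [Complex.sub_re, Complex.mul_re, Complex.ofReal_re, Complex.ofReal_im, Complex.re_ofNat,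
    Complex.im_ofNat] at h2
  linarith

theorem memLp_mul_continuous_of_compact {f : ℝ → ℂ} (hf : MemLp f 2 volume) {K : Set ℝ}
    (hK : IsCompact K) (h0 : ∀ᵐ x : ℝ, x ∉ K → f x = 0) {u : ℝ → ℂ} (hu : Continuous u) :
    MemLp (fun x => f x * u x) 2 volume := by
  obtain ⟨C, hC⟩ := hK.exists_bound_of_continuousOn hu.continuousOn
  refine hf.of_le_mul (c := C) (hf.aestronglyMeasurable.mul hu.aestronglyMeasurable) ?_
  filter_upwards [h0] with x hx
  by_cases hm : x ∈ K
  · rw [norm_mul, mul_comm]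
    exact mul_le_mul_of_nonneg_right (hC x hm) (norm_nonneg _)
  · simp [hx hm]

/-- A lower bound for `L₀₀` controls truncated eigenfunctions of `L`. -/
theorem Admissible.integral_cutoff_le {p Q r s : ℝ → ℝ} (hc : Admissible p Q r s) {c : ℝ}
    (hbelow : ∀ w ∈ (preminOp p Q r s).graph, c * ‖w.1‖ ^ 2 ≤ (⟪w.1, w.2⟫_ℂ).re)
    {u v g : ℝ → ℂ} (hu : IsQuasiSolution p Q r s u v g)
    (hg : g =ᵐ[volume] fun x => ((c - 1 : ℝ) : ℂ) * u x) {φ P : ℝ → ℝ} (hφ : ContDiff ℝ ∞ φ)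
    (hφc : HasCompactSupport φ) (hP : ∀ c d, AbsolutelyContinuousOnInterval P c d)
    (hPe : P =ᵐ[volume] fun x => p x * deriv φ x) (hP2 : MemLp (deriv P) 2 volume)
    (hQ2 : MemLp (fun x => deriv φ x * Q x) 2 volume) :
    ∫ x, φ x ^ 2 * ‖u x‖ ^ 2 ≤ ∫ x, deriv φ x * P x * ‖u x‖ ^ 2 := by
  set w : ℝ → ℂ := fun x => φ x * u x with hw
  set h : ℝ → ℂ := fun x => φ x * g x - 2 * deriv φ x * (v x + Q x * u x) - deriv P x * u x
    with hh
  have hsol : IsQuasiSolution p Q r s w _ h := hc.isQuasiSolution_cutoff hu hφ hP hPe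
  have huc := hu.ac.continuous
  have hvc := hu.ac_quasiDeriv.continuous
  have hPc := continuous_of_absolutelyContinuous hP
  have hφ'c : Continuous (deriv φ) := (contDiff_infty_iff_deriv.1 hφ).2.continuous
  have hφ's : HasCompactSupport (deriv φ) := hφc.deriv
  have hof : ∀ {f : ℝ → ℝ}, HasCompactSupport f → HasCompactSupport fun x => (f x : ℂ) :=
    fun hf => hf.comp_left (g := fun t : ℝ => (t : ℂ)) Complex.ofReal_zero
  have hwc : HasCompactSupport w := (hof hφc).mul_right
  have hwm : MemLp w 2 volume := hsol.ac.continuous.memLp_of_hasCompactSupport hwc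
  have hPd0 : ∀ x, x ∉ tsupport (deriv φ) → deriv P x = 0 := by
    intro x hx
    have hU : IsOpen (tsupport (deriv φ))ᶜ := (isClosed_tsupport _).isOpen_compl
    have h0 : Set.EqOn P (fun _ => 0) (tsupport (deriv φ))ᶜ := by
      refine Measure.eqOn_open_of_ae_eq (μ := volume)
        ((ae_restrict_iff' hU.measurableSet).2 ?_) hU hPc.continuousOn continuousOn_const
      filter_upwards [hPe] with t ht hm
      rw [ht, image_eq_zero_of_notMem_tsupport hm, mul_zero]
    rw [(h0.eventuallyEq_of_mem (hU.mem_nhds hx)).deriv_eq, deriv_const]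
  have hhm : MemLp h 2 volume := by
    have m1 : MemLp (fun x => φ x * g x) 2 volume := by
      refine (hwm.const_mul ((c - 1 : ℝ) : ℂ)).ae_eq ?_
      filter_upwards [hg] with x hx
      rw [hx, hw]
      ring
    have m2 : MemLp (fun x => ((deriv φ x : ℝ) : ℂ) * v x) 2 volume :=
      ((Complex.continuous_ofReal.comp hφ'c).mul hvc).memLp_of_hasCompactSupport
        (hof hφ's).mul_right
    have m3 : MemLp (fun x => ((deriv φ x * Q x : ℝ) : ℂ) * u x) 2 volume := by
      refine memLp_mul_continuous_of_compact hQ2.ofReal hφ's.isCompact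
        (Eventually.of_forall fun x hx => ?_) huc
      rw [image_eq_zero_of_notMem_tsupport hx]
      simp
    have m4 : MemLp (fun x => ((deriv P x : ℝ) : ℂ) * u x) 2 volume := by
      refine memLp_mul_continuous_of_compact hP2.ofReal hφ's.isCompact
        (Eventually.of_forall fun x hx => ?_) huc
      rw [hPd0 x hx]
      simp
    refine ((m1.sub ((m2.add m3).const_mul 2)).sub m4).ae_eq (Eventually.of_forall fun x => ?_)
    simp only [hh, Pi.sub_apply, Pi.add_apply]
    push_cast
    ring
  have hmem : (hwm.toLp w, hhm.toLp h) ∈ (preminOp p Q r s).graph :=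
    mem_graph_preminOp_iff.2 ⟨mem_maxGraph_iff.2 ⟨w, _, hwm.coeFn_toLp,
      hsol.congr hhm.coeFn_toLp⟩, w, hwc, hwm.coeFn_toLp⟩
  have hb := hbelow _ hmem
  have i1 : Integrable (fun x => φ x ^ 2 * ‖u x‖ ^ 2) volume := by
    refine ((hφ.continuous.pow 2).mul (huc.norm.pow 2)).integrable_of_hasCompactSupport ?_
    exact HasCompactSupport.intro hφc.isCompact fun x hx => by
      simp [image_eq_zero_of_notMem_tsupport hx]
  have i2 : Integrable (fun x => deriv φ x * P x * ‖u x‖ ^ 2) volume :=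
    ((hφ'c.mul hPc).mul (huc.norm.pow 2)).integrable_of_hasCompactSupport
      (hφ's.mul_right.mul_right)
  set N : ℝ → ℂ := fun x => φ x * P x * (u x * conj (u x)) with hN
  have hNac : ACLoc N := ((ACLoc.ofReal (absolutelyContinuous_of_contDiff hφ)).mul
    (ACLoc.ofReal hP)).mul (hu.ac.mul hu.ac.conj)
  obtain ⟨R, hR, hKR⟩ := exists_compact_interval hφc.isCompact
  have hN0 : ∀ x, x ∉ Set.Icc (-R) R → N x = 0 := fun x hx => by
    simp [hN, image_eq_zero_of_notMem_tsupport fun h => hx (hKR h)]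
  have hNd0 : ∀ x, x ∉ Set.Icc (-R) R → deriv N x = 0 := fun x hx => by
    have hU : IsOpen (Set.Icc (-R) R)ᶜ := isClosed_Icc.isOpen_compl
    have h0 : Set.EqOn N (fun _ => 0) (Set.Icc (-R) R)ᶜ := hN0
    rw [(h0.eventuallyEq_of_mem (hU.mem_nhds hx)).deriv_eq, deriv_const]
  have hRR : R < R + 1 := by linarith
  have hNint : ∫ x, deriv N x = 0 := by
    rw [integral_eq_intervalIntegral hR hRR (Eventually.of_forall hNd0), hNac.integral_deriv,
      hN0 (R + 1) fun h => by linarith [h.2], hN0 (-(R + 1)) fun h => by linarith [h.1], sub_zero]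
  have hNi : Integrable (deriv N) volume := by
    have h1 := hNac.intervalIntegrable_deriv (-(R + 1)) (R + 1)
    rw [intervalIntegrable_iff, Set.uIoc_of_le (by linarith)] at h1
    refine (integrableOn_iff_integrable_of_support_subset fun x hx => ?_).1 h1
    by_contra hm
    exact hx (hNd0 x fun h' => hm ⟨by linarith [h'.1], by linarith [h'.2]⟩)
  have hnorm : ‖hwm.toLp w‖ ^ 2 = ∫ x, φ x ^ 2 * ‖u x‖ ^ 2 := by
    have h1 : ⟪hwm.toLp w, hwm.toLp w⟫_ℂ = ((∫ x, φ x ^ 2 * ‖u x‖ ^ 2 : ℝ) : ℂ) := by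
      rw [L2_inner_eq, ← integral_complex_ofReal]
      refine integral_congr_ae ?_
      filter_upwards [hwm.coeFn_toLp] with x hx
      rw [hx, Complex.mul_conj, Complex.normSq_eq_norm_sq, hw]
      simp [mul_pow]
    rw [← inner_self_eq_norm_sq (𝕜 := ℂ), h1]
    exact Complex.ofReal_re _
  have hinner : (⟪hwm.toLp w, hhm.toLp h⟫_ℂ).re =
      (c - 1) * (∫ x, φ x ^ 2 * ‖u x‖ ^ 2) + ∫ x, deriv φ x * P x * ‖u x‖ ^ 2 := by
    have hwi : Integrable (fun x => h x * conj (w x)) volume := hhm.integrable_mul hwm.star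
    have h1 : ⟪hwm.toLp w, hhm.toLp h⟫_ℂ = ∫ x, h x * conj (w x) := by
      rw [L2_inner_eq]
      refine integral_congr_ae ?_
      filter_upwards [hwm.coeFn_toLp, hhm.coeFn_toLp] with x hx hx'
      rw [hx, hx']
    have h2 : (∫ x, h x * conj (w x)).re = ∫ x, (h x * conj (w x)).re :=
      (integral_re hwi).symm
    have h3 : ∫ x, (deriv N x).re = 0 := by
      have := integral_re (𝕜 := ℂ) hNi
      rw [hNint] at this
      simpa using this
    rw [h1, h2, ← integral_const_mul, ← integral_add (i1.const_mul _) i2,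
      integral_congr_ae (hc.cutoff_energy_ae hu hg hφ hP hPe)]
    refine (integral_sub ((i1.const_mul (c - 1)).add i2) hNi.re).trans ?_
    change _ - ∫ x, (deriv N x).re = _
    rw [h3, sub_zero]
    rfl
  rw [hnorm, hinner] at hb
  linarith

/-! ### Triviality of the kernel -/

/-- Smooth steps on arbitrary intervals with a scale invariant derivative bound. -/
theorem exists_smooth_step : ∃ K : ℝ, 0 < K ∧ ∀ a b : ℝ, a < b → ∃ σ : ℝ → ℝ, ContDiff ℝ ∞ σ ∧
    (∀ x ≤ a, σ x = 0) ∧ (∀ x, b ≤ x → σ x = 1) ∧ tsupport (deriv σ) ⊆ Set.Ioo a b ∧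
    ∀ x, |deriv σ x| ≤ K / (b - a) := by
  have hτ : ContDiff ℝ ∞ Real.smoothTransition := Real.smoothTransition.contDiff
  have hτd : Differentiable ℝ Real.smoothTransition := hτ.differentiable (by simp)
  have hτ0 : ∀ x, x ∉ Set.Icc (0 : ℝ) 1 → deriv Real.smoothTransition x = 0 := by
    intro x hx
    rcases lt_or_ge x 0 with h | h
    · have : Real.smoothTransition =ᶠ[𝓝 x] fun _ => 0 := by
        filter_upwards [Iio_mem_nhds h] with y hy
        exact Real.smoothTransition.zero_of_nonpos (le_of_lt hy)
      rw [this.deriv_eq, deriv_const]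
    · have h1 : 1 < x := by
        by_contra hcon
        exact hx ⟨h, not_lt.1 hcon⟩
      have : Real.smoothTransition =ᶠ[𝓝 x] fun _ => 1 := by
        filter_upwards [Ioi_mem_nhds h1] with y hy
        exact Real.smoothTransition.one_of_one_le (le_of_lt hy)
      rw [this.deriv_eq, deriv_const]
  obtain ⟨C, hC⟩ := (HasCompactSupport.intro isCompact_Icc hτ0).exists_bound_of_continuous
    (contDiff_infty_iff_deriv.1 hτ).2.continuous
  refine ⟨3 * (|C| + 1), by positivity, fun a b hab => ?_⟩
  have hpos : 0 < b - a := sub_pos.2 hab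
  have hd : ∀ x, HasDerivAt (fun x => Real.smoothTransition (3 * (x - a) / (b - a) - 1))
      (deriv Real.smoothTransition (3 * (x - a) / (b - a) - 1) * (3 / (b - a))) x := by
    intro x
    have h1 : HasDerivAt (fun x => 3 * (x - a) / (b - a) - 1) (3 / (b - a)) x := by
      simpa using ((((hasDerivAt_id x).sub_const a).const_mul 3).div_const (b - a)).sub_const 1
    exact (hτd _).hasDerivAt.comp x h1
  refine ⟨fun x => Real.smoothTransition (3 * (x - a) / (b - a) - 1),
    hτ.comp (by fun_prop), fun x hx => ?_, fun x hx => ?_, ?_, fun x => ?_⟩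
  · refine Real.smoothTransition.zero_of_nonpos ?_
    have : 3 * (x - a) / (b - a) ≤ 0 := div_nonpos_of_nonpos_of_nonneg (by linarith) hpos.le
    linarith
  · refine Real.smoothTransition.one_of_one_le ?_
    have : 3 ≤ 3 * (x - a) / (b - a) := by
      rw [le_div_iff₀ hpos]
      linarith
    linarith
  · have hsub : tsupport (deriv fun x => Real.smoothTransition (3 * (x - a) / (b - a) - 1)) ⊆
        Set.Icc (a + (b - a) / 3) (a + 2 * (b - a) / 3) := by
      refine closure_minimal (fun x hx => ?_) isClosed_Icc
      by_contra hm
      refine hx ?_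
      rw [(hd x).deriv, hτ0, zero_mul]
      intro h
      refine hm ⟨?_, ?_⟩
      · have h1 := h.1
        have : 1 ≤ 3 * (x - a) / (b - a) := by linarith
        rw [le_div_iff₀ hpos] at this
        linarith
      · have h1 := h.2
        have : 3 * (x - a) / (b - a) ≤ 2 := by linarith
        rw [div_le_iff₀ hpos] at this
        linarith
    refine hsub.trans fun x hx => ⟨?_, ?_⟩
    · linarith [hx.1]
    · linarith [hx.2]
  · rw [(hd x).deriv, abs_mul, abs_of_pos (by positivity : 0 < 3 / (b - a))]
    have h1 : |deriv Real.smoothTransition (3 * (x - a) / (b - a) - 1)| ≤ |C| + 1 :=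
      ((hC _).trans (le_abs_self C)).trans (by linarith)
    calc _ ≤ (|C| + 1) * (3 / (b - a)) := mul_le_mul_of_nonneg_right h1 (by positivity)
      _ = 3 * (|C| + 1) / (b - a) := by ring

theorem Admissible.exists_transition {p Q r s : ℝ → ℝ} (hc : Admissible p Q r s)
    {a b C K : ℝ} (hab : a < b) (hC : 0 < C) (hK : 0 < K) (hp : MemW12 p a b)
    (hpos : ∀ᵐ x : ℝ, x ∈ Set.Icc a b → 0 < p x)
    (hbound : ∀ᵐ x : ℝ, x ∈ Set.Icc a b → p x ≤ C * (b - a) ^ 2)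
    {σ : ℝ → ℝ} (hσ : ContDiff ℝ ∞ σ) (hsupp : tsupport (deriv σ) ⊆ Set.Ioo a b)
    (hσK : ∀ x, |deriv σ x| ≤ K / (b - a)) :
    ∃ P : ℝ → ℝ, (∀ c d, AbsolutelyContinuousOnInterval P c d) ∧
      (P =ᵐ[volume] fun x => p x * deriv σ x) ∧ MemLp (deriv P) 2 volume ∧
      MemLp (fun x => deriv σ x * Q x) 2 volume ∧
      ∀ᵐ x : ℝ, deriv σ x * (p x * deriv σ x) ≤ (Set.Icc a b).indicator (fun _ => C * K ^ 2) x := by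
  have hσ' : ContDiff ℝ ∞ (deriv σ) := (contDiff_infty_iff_deriv.1 hσ).2
  have hba : 0 < b - a := sub_pos.2 hab
  have hσ0 : ∀ x, x ∉ Set.Icc a b → deriv σ x = 0 := fun x hx =>
    image_eq_zero_of_notMem_tsupport fun h => hx (Set.Ioo_subset_Icc_self (hsupp h))
  have hsq : ∀ᵐ x : ℝ, x ∈ Set.Icc a b → deriv σ x ^ 2 * p x ≤ C * K ^ 2 := by
    filter_upwards [hpos, hbound] with x h1 h2 hx
    have h3 : deriv σ x ^ 2 ≤ (K / (b - a)) ^ 2 := by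
      rw [← sq_abs]
      exact pow_le_pow_left₀ (abs_nonneg _) (hσK x) 2
    calc deriv σ x ^ 2 * p x ≤ (K / (b - a)) ^ 2 * (C * (b - a) ^ 2) :=
          mul_le_mul h3 (h2 hx) (h1 hx).le (by positivity)
      _ = C * K ^ 2 := by field_simp
  obtain ⟨P, hPac, hPe, hP2⟩ := hp.exists_mul_version hab hσ' hsupp
  refine ⟨P, hPac, hPe, hP2, ?_, ?_⟩
  · have hF : MemLp ((Set.Icc a b).indicator fun x => Q x / √|p x|) 2 volume :=
      (memLp_indicator_iff_restrict measurableSet_Icc).2 (hc.Q_div_sqrt _ isCompact_Icc)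
    refine hF.of_le_mul (c := √(C * K ^ 2)) (hσ'.continuous.aestronglyMeasurable.mul
      (hc.aestronglyMeasurable_of_div hc.Q_div_sqrt)) ?_
    filter_upwards [hsq, hpos] with x h1 h2
    by_cases hx : x ∈ Set.Icc a b
    · rw [Set.indicator_of_mem hx]
      have hp0 := h2 hx
      have hs0 : 0 < √|p x| := Real.sqrt_pos.2 (abs_pos.2 hp0.ne')
      have h3 : |deriv σ x| * √|p x| ≤ √(C * K ^ 2) := by
        refine Real.le_sqrt_of_sq_le ?_
        rw [mul_pow, sq_abs, Real.sq_sqrt (abs_nonneg _), abs_of_pos hp0]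
        exact h1 hx
      rw [norm_mul, norm_div, Real.norm_eq_abs, Real.norm_of_nonneg hs0.le]
      calc |deriv σ x| * ‖Q x‖ = |deriv σ x| * √|p x| * (‖Q x‖ / √|p x|) := by field_simp
        _ ≤ _ := mul_le_mul_of_nonneg_right h3 (by positivity)
    · rw [Set.indicator_of_notMem hx, hσ0 x hx]
      simp
  · filter_upwards [hsq] with x h1
    by_cases hx : x ∈ Set.Icc a b
    · rw [Set.indicator_of_mem hx]
      linarith [h1 hx, (by ring : deriv σ x * (p x * deriv σ x) = deriv σ x ^ 2 * p x)]
    · rw [Set.indicator_of_notMem hx, hσ0 x hx]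
      simp

/-- The mass of an eigenfunction between two transition intervals is controlled by its mass on
these intervals. -/
theorem Admissible.integral_le_of_transition {p Q r s : ℝ → ℝ} (hc : Admissible p Q r s) {c : ℝ}
    (hbelow : ∀ w ∈ (preminOp p Q r s).graph, c * ‖w.1‖ ^ 2 ≤ (⟪w.1, w.2⟫_ℂ).re)
    {u v g : ℝ → ℂ} (hu : IsQuasiSolution p Q r s u v g) (hu2 : MemLp u 2 volume)
    (hg : g =ᵐ[volume] fun x => ((c - 1 : ℝ) : ℂ) * u x)
    {C K a b a' b' : ℝ} (hab : a < b) (hab' : a' < b') (hle : b ≤ a')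
    {σ σ' P P' : ℝ → ℝ} (hσ : ContDiff ℝ ∞ σ) (hσ' : ContDiff ℝ ∞ σ')
    (h0 : ∀ x ≤ a, σ x = 0) (h1 : ∀ x, b ≤ x → σ x = 1)
    (h0' : ∀ x ≤ a', σ' x = 0) (h1' : ∀ x, b' ≤ x → σ' x = 1)
    (hs : tsupport (deriv σ) ⊆ Set.Ioo a b) (hs' : tsupport (deriv σ') ⊆ Set.Ioo a' b')
    (hP : ∀ c d, AbsolutelyContinuousOnInterval P c d)
    (hP' : ∀ c d, AbsolutelyContinuousOnInterval P' c d)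
    (hPe : P =ᵐ[volume] fun x => p x * deriv σ x)
    (hPe' : P' =ᵐ[volume] fun x => p x * deriv σ' x)
    (hP2 : MemLp (deriv P) 2 volume) (hP2' : MemLp (deriv P') 2 volume)
    (hQ2 : MemLp (fun x => deriv σ x * Q x) 2 volume)
    (hQ2' : MemLp (fun x => deriv σ' x * Q x) 2 volume)
    (hb : ∀ᵐ x : ℝ, deriv σ x * (p x * deriv σ x) ≤ (Set.Icc a b).indicator (fun _ => C * K ^ 2) x)
    (hb' : ∀ᵐ x : ℝ, deriv σ' x * (p x * deriv σ' x) ≤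
      (Set.Icc a' b').indicator (fun _ => C * K ^ 2) x) :
    ∫ x in b..a', ‖u x‖ ^ 2 ≤
      C * K ^ 2 * (∫ x in a..b, ‖u x‖ ^ 2) + C * K ^ 2 * ∫ x in a'..b', ‖u x‖ ^ 2 := by
  have hd : ∀ x, deriv (fun x => σ x - σ' x) x = deriv σ x - deriv σ' x := fun x =>
    deriv_fun_sub (hσ.differentiable (by simp) x) (hσ'.differentiable (by simp) x)
  have hφc : HasCompactSupport fun x => σ x - σ' x := by
    refine HasCompactSupport.intro (isCompact_Icc (a := a) (b := b')) fun x hx => ?_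
    rcases le_or_gt x a with h | h
    · rw [h0 x h, h0' x (by linarith), sub_zero]
    · have : b' < x := by
        by_contra hcon
        exact hx ⟨h.le, not_lt.1 hcon⟩
      rw [h1 x (by linarith), h1' x this.le, sub_self]
  have hInt : Integrable (fun x => ‖u x‖ ^ 2) volume :=
    (memLp_two_iff_integrable_sq_norm hu2.aestronglyMeasurable).1 hu2
  have hPd := ae_differentiableAt_of_absolutelyContinuous hP
  have hPd' := ae_differentiableAt_of_absolutelyContinuous hP'
  have hmain := hc.integral_cutoff_le hbelow hu hg (hσ.sub hσ') hφc
    (P := fun x => P x - P' x) (fun c d => (hP c d).fun_sub (hP' c d)) (by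
      filter_upwards [hPe, hPe'] with x e e'
      rw [e, e', hd]
      ring) (by
      refine (hP2.sub hP2').ae_eq ?_
      filter_upwards [hPd, hPd'] with x d d'
      rw [deriv_fun_sub d d', Pi.sub_apply]) (by
      refine (hQ2.sub hQ2').ae_eq (Eventually.of_forall fun x => ?_)
      simp only [hd, Pi.sub_apply]
      ring)
  have hlow : ∫ x in b..a', ‖u x‖ ^ 2 ≤ ∫ x, (σ x - σ' x) ^ 2 * ‖u x‖ ^ 2 := by
    rw [intervalIntegral.integral_of_le hle, ← integral_indicator measurableSet_Ioc]
    refine integral_mono_of_nonneg (Eventually.of_forall fun x => ?_) ?_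
      (Eventually.of_forall fun x => ?_)
    · exact Set.indicator_nonneg (fun _ _ => by positivity) x
    · refine (((hσ.continuous.sub hσ'.continuous).pow 2).mul
        (hu.ac.continuous.norm.pow 2)).integrable_of_hasCompactSupport ?_
      exact HasCompactSupport.intro hφc.isCompact fun x hx => by
        have := image_eq_zero_of_notMem_tsupport hx
        simp [this]
    · by_cases hx : x ∈ Set.Ioc b a'
      · simp [Set.indicator_of_mem hx, h1 x hx.1.le, h0' x hx.2]
      · rw [Set.indicator_of_notMem hx]
        positivity
  have hindi : ∀ c d : ℝ, Integrable ((Set.Icc c d).indicator fun x => C * K ^ 2 * ‖u x‖ ^ 2)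
      volume := fun c d => (hInt.const_mul _).indicator measurableSet_Icc
  have hup : ∫ x, deriv (fun x => σ x - σ' x) x * (P x - P' x) * ‖u x‖ ^ 2 ≤
      ∫ x, ((Set.Icc a b).indicator (fun x => C * K ^ 2 * ‖u x‖ ^ 2) x +
        (Set.Icc a' b').indicator (fun x => C * K ^ 2 * ‖u x‖ ^ 2) x) := by
    refine integral_mono_ae ?_ ((hindi a b).add (hindi a' b')) ?_
    · have hφ'c : Continuous (deriv fun x => σ x - σ' x) :=
        (contDiff_infty_iff_deriv.1 (hσ.sub hσ')).2.continuous
      refine ((hφ'c.mul ((continuous_of_absolutelyContinuous hP).sub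
        (continuous_of_absolutelyContinuous hP'))).mul
        (hu.ac.continuous.norm.pow 2)).integrable_of_hasCompactSupport ?_
      exact HasCompactSupport.intro hφc.deriv.isCompact fun x hx => by
        simp [image_eq_zero_of_notMem_tsupport hx]
    · filter_upwards [hPe, hPe', hb, hb'] with x e e' k k'
      have hz : deriv σ x * deriv σ' x = 0 := by
        by_contra hne
        obtain ⟨n1, n2⟩ := mul_ne_zero_iff.1 hne
        have m1 := hs (subset_tsupport _ n1)
        have m2 := hs' (subset_tsupport _ n2)
        linarith [m1.2, m2.1]
      have hk : deriv (fun x => σ x - σ' x) x * (P x - P' x) ≤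
          (Set.Icc a b).indicator (fun _ => C * K ^ 2) x +
          (Set.Icc a' b').indicator (fun _ => C * K ^ 2) x := by
        rw [hd, e, e']
        calc _ = deriv σ x * (p x * deriv σ x) + deriv σ' x * (p x * deriv σ' x) := by
              linear_combination (-2 * p x) * hz
          _ ≤ _ := add_le_add k k'
      have := mul_le_mul_of_nonneg_right hk (sq_nonneg ‖u x‖)
      refine this.trans (le_of_eq ?_)
      simp only [add_mul, Set.indicator_apply]
      split_ifs <;> simp
  rw [integral_add (hindi a b) (hindi a' b'), integral_indicator measurableSet_Icc,
    integral_indicator measurableSet_Icc, integral_const_mul, integral_const_mul,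
    integral_Icc_eq_integral_Ioc, integral_Icc_eq_integral_Ioc,
    ← intervalIntegral.integral_of_le hab.le, ← intervalIntegral.integral_of_le hab'.le] at hup
  exact hlow.trans (hmain.trans hup)

theorem tendsto_integral_of_tendsto_atTop {f : ℝ → ℝ} (hf : Integrable f volume) {ι : Type*}
    {l : Filter ι} [l.IsCountablyGenerated] {a b : ι → ℝ} (ha : Tendsto a l atTop)
    (hb : Tendsto b l atTop) : Tendsto (fun i => ∫ x in a i..b i, f x) l (𝓝 0) := by
  have h1 := intervalIntegral_tendsto_integral_Ioi 0 hf.integrableOn ha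
  have h2 := intervalIntegral_tendsto_integral_Ioi 0 hf.integrableOn hb
  have h := h2.sub h1
  rw [sub_self] at h
  refine h.congr fun i => ?_
  rw [intervalIntegral.integral_interval_sub_left] <;> exact hf.intervalIntegrable

theorem tendsto_integral_of_tendsto_atBot {f : ℝ → ℝ} (hf : Integrable f volume) {ι : Type*}
    {l : Filter ι} [l.IsCountablyGenerated] {a b : ι → ℝ} (ha : Tendsto a l atBot)
    (hb : Tendsto b l atBot) : Tendsto (fun i => ∫ x in a i..b i, f x) l (𝓝 0) := by
  have h1 := intervalIntegral_tendsto_integral_Iic 0 hf.integrableOn ha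
  have h2 := intervalIntegral_tendsto_integral_Iic 0 hf.integrableOn hb
  have h := h1.sub h2
  rw [sub_self] at h
  refine h.congr fun i => ?_
  rw [sub_eq_iff_eq_add, intervalIntegral.integral_add_adjacent_intervals] <;>
    exact hf.intervalIntegrable

/-- Under the growth condition on `p`, the maximal operator has no eigenvalue one below the lower
bound of `L₀₀`. -/
theorem Admissible.eigenfunction_eq_zero {p Q r s : ℝ → ℝ} (hc : Admissible p Q r s) {c : ℝ}
    (hbelow : ∀ w ∈ (preminOp p Q r s).graph, c * ‖w.1‖ ^ 2 ≤ (⟪w.1, w.2⟫_ℂ).re)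
    {a b : ℤ → ℝ} (hab : ∀ n, a n < b n)
    (hb : Tendsto b atBot atBot) (ha : Tendsto a atTop atTop)
    (hp : ∀ n, MemW12 p (a n) (b n))
    (hpos : ∀ n, ∀ᵐ x : ℝ, x ∈ Set.Icc (a n) (b n) → 0 < p x) {C : ℝ} (hC : 0 < C)
    (hbound : ∀ n, ∀ᵐ x : ℝ, x ∈ Set.Icc (a n) (b n) → p x ≤ C * (b n - a n) ^ 2)
    {f : L2} (hf : (f, ((c - 1 : ℝ) : ℂ) • f) ∈ maxGraph p Q r s) : f = 0 := by
  obtain ⟨u, v, hfu, hu⟩ := mem_maxGraph_iff.1 hf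
  have hu2 : MemLp u 2 volume := (Lp.memLp f).ae_eq hfu
  have hg : (((c - 1 : ℝ) : ℂ) • f : L2) =ᵐ[volume] fun x => ((c - 1 : ℝ) : ℂ) * u x := by
    filter_upwards [Lp.coeFn_smul ((c - 1 : ℝ) : ℂ) f, hfu] with x hx e
    rw [hx, Pi.smul_apply, e, smul_eq_mul]
  obtain ⟨K, hK, hstep⟩ := exists_smooth_step
  choose σ hσ h0 h1 hs hσK using fun n => hstep (a n) (b n) (hab n)
  choose P hP hPe hP2 hQ2 hPb using fun n => hc.exists_transition (hab n) hC hK (hp n) (hpos n)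
    (hbound n) (hσ n) (hs n) (hσK n)
  have hInt : Integrable (fun x => ‖u x‖ ^ 2) volume :=
    (memLp_two_iff_integrable_sq_norm hu2.aestronglyMeasurable).1 hu2
  have hneg : Tendsto (fun k : ℤ => -k) atTop atBot := tendsto_neg_atTop_atBot
  have hbm : Tendsto (fun k : ℤ => b (-k)) atTop atBot := hb.comp hneg
  have ham : Tendsto (fun k : ℤ => a (-k)) atTop atBot :=
    tendsto_atBot_mono (fun k => (hab (-k)).le) hbm
  have hbp : Tendsto b atTop atTop := tendsto_atTop_mono (fun k => (hab k).le) ha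
  have hle : ∀ᶠ k : ℤ in atTop, ∫ x in b (-k)..a k, ‖u x‖ ^ 2 ≤
      C * K ^ 2 * (∫ x in a (-k)..b (-k), ‖u x‖ ^ 2) +
        C * K ^ 2 * ∫ x in a k..b k, ‖u x‖ ^ 2 := by
    filter_upwards [hbm.eventually_le_atBot 0, ha.eventually_ge_atTop 0] with k k1 k2
    exact hc.integral_le_of_transition hbelow hu hu2 hg (hab _) (hab _) (k1.trans k2) (hσ _) (hσ _)
      (h0 _) (h1 _) (h0 _) (h1 _) (hs _) (hs _) (hP _) (hP _) (hPe _) (hPe _) (hP2 _) (hP2 _)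
      (hQ2 _) (hQ2 _) (hPb _) (hPb _)
  have hlim := le_of_tendsto_of_tendsto
    (intervalIntegral_tendsto_integral hInt hbm ha)
    (((tendsto_integral_of_tendsto_atBot hInt ham hbm).const_mul (C * K ^ 2)).add
      ((tendsto_integral_of_tendsto_atTop hInt ha hbp).const_mul (C * K ^ 2))) hle
  simp only [mul_zero, add_zero] at hlim
  have hzero : ∫ x, ‖u x‖ ^ 2 = 0 := le_antisymm hlim (integral_nonneg fun x => by positivity)
  rw [integral_eq_zero_iff_of_nonneg (fun x => by positivity) hInt] at hzero
  refine Lp.ext (hfu.trans (EventuallyEq.trans ?_ (Lp.coeFn_zero _ _ _).symm))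
  filter_upwards [hzero] with x hx
  simpa using hx

/-! ### Essential self-adjointness -/

/-- If the symmetric operator `T` is bounded below by `c` and `c - 1` is not an eigenvalue of `T†`,
then the graph of `T†` is contained in the closure of the graph of `T`. -/
theorem adjoint_graph_le_topologicalClosure {H : Type*} [NormedAddCommGroup H]
    [InnerProductSpace ℂ H] [CompleteSpace H] {T : H →ₗ.[ℂ] H} (hT : Dense (T.domain : Set H))
    (hle : T ≤ T†) {c : ℝ} (hbelow : ∀ w ∈ T.graph, c * ‖w.1‖ ^ 2 ≤ (⟪w.1, w.2⟫_ℂ).re)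
    (hker : ∀ f, (f, ((c - 1 : ℝ) : ℂ) • f) ∈ T†.graph → f = 0) :
    T†.graph ≤ T.graph.topologicalClosure := by
  set l : ℂ := ((c - 1 : ℝ) : ℂ) with hl
  have hclosed : IsClosed (T†.graph : Set (H × H)) := LinearPMap.adjoint_isClosed hT
  have hcl : T.graph.topologicalClosure ≤ T†.graph :=
    Submodule.topologicalClosure_minimal _ (LinearPMap.le_graph_of_le hle) hclosed
  have hnorm : ∀ w ∈ T.graph, ‖w.1‖ ≤ ‖w.2 - l • w.1‖ := by
    intro w hw
    have h1 := hbelow w hw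
    have h2 : (⟪w.1, w.2 - l • w.1⟫_ℂ).re = (⟪w.1, w.2⟫_ℂ).re - (c - 1) * ‖w.1‖ ^ 2 := by
      rw [inner_sub_right, inner_smul_right, Complex.sub_re, hl, Complex.re_ofReal_mul]
      congr 2
      exact inner_self_eq_norm_sq (𝕜 := ℂ) w.1
    have h3 : (⟪w.1, w.2 - l • w.1⟫_ℂ).re ≤ ‖w.1‖ * ‖w.2 - l • w.1‖ :=
      re_inner_le_norm (𝕜 := ℂ) _ _
    rcases (norm_nonneg w.1).eq_or_lt with h0 | h0
    · rw [← h0]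
      exact norm_nonneg _
    · refine le_of_mul_le_mul_left ?_ h0
      nlinarith
  set S : Submodule ℂ H := T.graph.map
    (LinearMap.snd ℂ H H - l • LinearMap.fst ℂ H H) with hS
  have hSdense : S.topologicalClosure = ⊤ := by
    rw [Submodule.topologicalClosure_eq_top_iff, Submodule.eq_bot_iff]
    intro y hy
    refine hker y ?_
    rw [LinearPMap.adjoint_graph_eq_graph_adjoint hT, Submodule.mem_adjoint_iff]
    intro a b hab
    have := (Submodule.mem_orthogonal _ _).1 hy (b - l • a) ⟨(a, b), hab, by simp⟩
    rw [inner_sub_left, inner_smul_left, hl, Complex.conj_ofReal] at this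
    rw [inner_smul_right]
    exact this
  rintro ⟨f, g⟩ hfg
  have hmem : g - l • f ∈ S.topologicalClosure := hSdense ▸ Submodule.mem_top
  rw [← SetLike.mem_coe, Submodule.topologicalClosure_coe] at hmem
  obtain ⟨t, ht, htl⟩ := mem_closure_iff_seq_limit.1 hmem
  choose w hw hwt using ht
  have hwt' : ∀ n, (w n).2 - l • (w n).1 = t n := fun n => by simpa using hwt n
  have hcau : CauchySeq fun n => (w n).1 := by
    have hct := htl.cauchySeq
    rw [Metric.cauchySeq_iff'] at hct ⊢
    intro ε hε
    obtain ⟨N, hN⟩ := hct ε hε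
    refine ⟨N, fun n hn => lt_of_le_of_lt ?_ (hN n hn)⟩
    rw [dist_eq_norm, dist_eq_norm, ← hwt' n, ← hwt' N]
    have := hnorm _ (T.graph.sub_mem (hw n) (hw N))
    refine this.trans (le_of_eq ?_)
    congr 1
    simp only [Prod.fst_sub, Prod.snd_sub, smul_sub]
    abel
  obtain ⟨x, hx⟩ := cauchySeq_tendsto_of_complete hcau
  have hx2 : Tendsto (fun n => (w n).2) atTop (𝓝 (g - l • f + l • x)) := by
    refine (htl.add (hx.const_smul l)).congr fun n => ?_
    rw [← hwt' n, sub_add_cancel]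
  have hxc : (x, g - l • f + l • x) ∈ T.graph.topologicalClosure := by
    rw [← SetLike.mem_coe, Submodule.topologicalClosure_coe]
    exact mem_closure_of_tendsto (hx.prodMk_nhds hx2) (Eventually.of_forall hw)
  have hd := hker (f - x) (by
    convert T†.graph.sub_mem hfg (hcl hxc) using 1
    rw [Prod.mk_sub_mk, smul_sub]
    congr 1
    abel)
  have hfx : f = x := sub_eq_zero.1 hd
  subst hfx
  simpa using hxc

theorem adjoint_graph_topologicalClosure {H : Type*} [NormedAddCommGroup H]
    [InnerProductSpace ℂ H] (g : Submodule ℂ (H × H)) :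
    g.topologicalClosure.adjoint = g.adjoint := by
  ext f
  rw [Submodule.mem_adjoint_iff, Submodule.mem_adjoint_iff]
  refine ⟨fun h a b hab => h a b (g.le_topologicalClosure hab), fun h a b hab => ?_⟩
  have hcl : IsClosed {w : H × H | ⟪w.2, f.1⟫_ℂ - ⟪w.1, f.2⟫_ℂ = 0} :=
    isClosed_eq (by fun_prop) continuous_const
  exact closure_minimal (fun w hw => h w.1 w.2 hw) hcl hab

end SturmLiouville

end

theorem theorem2 (p Q r s : ℝ → ℝ) (hcoef : SturmLiouville.Admissible p Q r s)
    (hbelow : SturmLiouville.BoundedBelow (SturmLiouville.preminOp p Q r s))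
    (a b : ℤ → ℝ) (hab : ∀ n, a n < b n)
    (hb : Tendsto b atBot atBot) (ha : Tendsto a atTop atTop)
    (hp : ∀ n, SturmLiouville.MemW12 p (a n) (b n))
    (hpos : ∀ n, ∀ᵐ x : ℝ, x ∈ Set.Icc (a n) (b n) → 0 < p x)
    (hbound : ∃ C : ℝ, 0 < C ∧
      ∀ n, ∀ᵐ x : ℝ, x ∈ Set.Icc (a n) (b n) → p x ≤ C * (b n - a n) ^ 2) :
    SturmLiouville.EssentiallySelfAdjoint (SturmLiouville.preminOp p Q r s) ∧
      (SturmLiouville.preminOp p Q r s)† = SturmLiouville.maxOp p Q r s ∧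
      SturmLiouville.maxOp p Q r s = (SturmLiouville.maxOp p Q r s)† := by
  obtain ⟨C, hC, hbound⟩ := hbound
  obtain ⟨c, hc⟩ := hbelow
  set T := SturmLiouville.preminOp p Q r s with hT
  set L := SturmLiouville.maxOp p Q r s with hL
  have hbelow' : ∀ w ∈ T.graph, c * ‖w.1‖ ^ 2 ≤ (⟪w.1, w.2⟫_ℂ).re := by
    intro w hw
    obtain ⟨y, hy, hyw⟩ := (LinearPMap.mem_graph_iff _).1 hw
    rw [← hy, ← hyw]
    exact hc y
  have hdense : Dense (T.domain : Set SturmLiouville.L2) := hcoef.dense_domain_preminOp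
  have hadj : T† = L := hcoef.adjoint_preminOp
  have hle : T ≤ L := SturmLiouville.preminOp_le_maxOp p Q r s
  have hLclosed : L.IsClosed := hadj ▸ LinearPMap.adjoint_isClosed hdense
  have hclosable : T.IsClosable := hLclosed.isClosable.leIsClosable hle
  have hgraph : T.graph.topologicalClosure = L.graph := by
    refine le_antisymm (Submodule.topologicalClosure_minimal _
      (LinearPMap.le_graph_of_le hle) hLclosed) ?_
    rw [← hadj]
    refine SturmLiouville.adjoint_graph_le_topologicalClosure hdense (hadj ▸ hle) hbelow'
      fun f hf => ?_
    rw [hadj, hL, SturmLiouville.graph_maxOp] at hf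
    exact hcoef.eigenfunction_eq_zero hbelow' hab hb ha hp hpos hC hbound hf
  have hclosure : T.closure = L :=
    LinearPMap.eq_of_eq_graph (hclosable.graph_closure_eq_closure_graph.symm.trans hgraph)
  have hLdense : Dense (L.domain : Set SturmLiouville.L2) := hdense.mono hle.1
  have hself : L† = L := by
    apply LinearPMap.eq_of_eq_graph
    rw [LinearPMap.adjoint_graph_eq_graph_adjoint hLdense, ← hgraph,
      SturmLiouville.adjoint_graph_topologicalClosure,
      ← LinearPMap.adjoint_graph_eq_graph_adjoint hdense, hadj, hgraph]
  refine ⟨⟨hdense, hclosable, ?_⟩, hadj, hself.symm⟩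
  rw [hclosure]
  exact hself
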